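/- Consider the relation schema $R(A,B)$. A database $D$ over $R$ is a finite set of facts $R(a,b)$. For a database $E$, a violation of the functional dependency $A\rightarrow B$ (respectively $B\rightarrow A$) in $E$ is an unordered pair of facts of $E$ that agree on $A$ and disagree on $B$ (respectively agree on $B$ and disagree on $A$); let $\mathsf{vio}(E,\varphi)$ be the set of violations of $\varphi$ in $E$. Let $\Delta=\{A\rightarrow B,\ B\rightarrow A\}$. Given a database $D$ with a nonnegative rational weight $w_f$ for every fact $f\in D$ and a nonnegative rational weight $w_\varphi$ for every $\varphi\in\Delta$, the cost of a subset $E\subseteq D$ is $$\mathsf{cost}(E\mid D)=\sum_{f\in D\setminus E}w_f+\sum_{\varphi\in\Delta}w_\varphi\,|\mathsf{vio}(E,\varphi)|.$$ Soft repairing for $R(A,B)$ and $\Delta$ is the following problem: given $D$ and the weights, where every weight is represented by an integer numerator and an integer denominator in binary, find a subset $E\subseteq D$ of minimal cost. Soft repairing for $R(A,B)$ and $\Delta=\{A\rightarrow B,\ B\rightarrow A\}$ is solvable in polynomial time: there is an algorithm that outputs such an $E$ for every input, in time polynomial in the number of bits of the input. -/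

import Mathlib

/-! ## Databases, functional dependencies and soft repairs -/

namespace SoftRepair

/-- A fact `R(c_1, …, c_k)` over a relation schema with `k` attributes. Constants are (names coded
by) natural numbers. -/
abbrev Fact (k : ℕ) : Type := Fin k → ℕ

/-- A functional dependency `X → Y` over a schema with `k` attributes. -/
structure FD (k : ℕ) where
  lhs : Finset (Fin k)
  rhs : Finset (Fin k)
  deriving DecidableEq

/-- `f[X] = g[X]`. -/
def AgreeOn {k : ℕ} (f g : Fact k) (X : Finset (Fin k)) : Prop := ∀ i ∈ X, f i = g i

open scoped Classical in
/-- The set of violations of `φ` in `D`: the unordered pairs `{f, g}` of facts of `D` that agree on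
the left-hand side of `φ` and disagree on its right-hand side. -/
noncomputable def vio {k : ℕ} (D : Finset (Fact k)) (φ : FD k) : Finset (Finset (Fact k)) :=
  (D.powersetCard 2).filter fun p =>
    ∃ f ∈ p, ∃ g ∈ p, AgreeOn f g φ.lhs ∧ ¬ AgreeOn f g φ.rhs

/-- The cost of the subset `E` of `D`: the weight of the deleted facts, plus the weight of every
functional dependency multiplied by the number of its violations in `E`. -/
noncomputable def cost {k : ℕ} (Δ : Finset (FD k)) (wFact : Fact k → ℚ) (wFD : FD k → ℚ)
    (D E : Finset (Fact k)) : ℚ :=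
  (∑ f ∈ D \ E, wFact f) + ∑ φ ∈ Δ, wFD φ * ((vio E φ).card : ℚ)

/-- `E` is an optimal subset of `D`. -/
def IsOptimalSubset {k : ℕ} (Δ : Finset (FD k)) (wFact : Fact k → ℚ) (wFD : FD k → ℚ)
    (D E : Finset (Fact k)) : Prop :=
  E ⊆ D ∧ ∀ E' : Finset (Fact k), E' ⊆ D →
    cost Δ wFact wFD D E ≤ cost Δ wFact wFD D E'

/-- A nonnegative rational weight, represented by an integer numerator and an integer denominator
(not necessarily in lowest terms). -/
structure Weight where
  num : ℤ
  den : ℤ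
  den_ne_zero : den ≠ 0
  nonneg : 0 ≤ (num : ℚ) / (den : ℚ)

/-- The rational number that a representation stands for. -/
def Weight.val (w : Weight) : ℚ := (w.num : ℚ) / (w.den : ℚ)

end SoftRepair

/-! ## Random access machines with logarithmic cost

The memory consists of arrays of integers of unbounded size, named by natural numbers; a program
mentions finitely many of them, and the index of a cell may be computed (indirect addressing). The
cost of an operation is measured by the bit lengths of the integers and cell indices involved, so
that polynomial time here is polynomial time on a Turing machine. -/

namespace RAM

/-- The contents of the memory: the array, then the index of the cell. -/
abbrev State : Type := ℕ → ℤ → ℤ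

/-- The length of an integer in binary, with one sign bit. -/
def len (z : ℤ) : ℕ := z.natAbs.size + 1

/-- Arithmetical expressions; `load a e` is the content of the cell of array `a` whose index is
the value of `e`. -/
inductive Expr : Type
  | const (z : ℤ) : Expr
  | load (a : ℕ) (e : Expr) : Expr
  | add (e₁ e₂ : Expr) : Expr
  | sub (e₁ e₂ : Expr) : Expr
  | mul (e₁ e₂ : Expr) : Expr
  | lt (e₁ e₂ : Expr) : Expr
  | eq (e₁ e₂ : Expr) : Expr

/-- The value of an expression (a comparison has value `1` if it holds, `0` otherwise). -/
def Expr.val (σ : State) : Expr → ℤ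
  | const z => z
  | load a e => σ a (e.val σ)
  | add e₁ e₂ => e₁.val σ + e₂.val σ
  | sub e₁ e₂ => e₁.val σ - e₂.val σ
  | mul e₁ e₂ => e₁.val σ * e₂.val σ
  | lt e₁ e₂ => if e₁.val σ < e₂.val σ then 1 else 0
  | eq e₁ e₂ => if e₁.val σ = e₂.val σ then 1 else 0

/-- The time to evaluate an expression: a memory access costs the length of the index and of the
content; addition, subtraction and comparisons cost the sum, and multiplication the product, of the
lengths of the operands. -/
def Expr.time (σ : State) : Expr → ℕ
  | const z => len z
  | load a e => e.time σ + len (e.val σ) + len (σ a (e.val σ))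
  | add e₁ e₂ => e₁.time σ + e₂.time σ + len (e₁.val σ) + len (e₂.val σ)
  | sub e₁ e₂ => e₁.time σ + e₂.time σ + len (e₁.val σ) + len (e₂.val σ)
  | mul e₁ e₂ => e₁.time σ + e₂.time σ + len (e₁.val σ) * len (e₂.val σ)
  | lt e₁ e₂ => e₁.time σ + e₂.time σ + len (e₁.val σ) + len (e₂.val σ)
  | eq e₁ e₂ => e₁.time σ + e₂.time σ + len (e₁.val σ) + len (e₂.val σ)

/-- Programs. A test `e` succeeds when the value of `e` is nonzero. -/
inductive Cmd : Type
  | skip : Cmd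
  | store (a : ℕ) (i e : Expr) : Cmd
  | seq (c₁ c₂ : Cmd) : Cmd
  | ite (e : Expr) (c₁ c₂ : Cmd) : Cmd
  | while (e : Expr) (c : Cmd) : Cmd

/-- Overwrite the cell `i` of array `a` with `z`. -/
def State.write (σ : State) (a : ℕ) (i z : ℤ) : State :=
  Function.update σ a (Function.update (σ a) i z)

/-- `Exec c σ t τ`: the program `c`, started with memory `σ`, halts after time `t` with
memory `τ`. -/
inductive Exec : Cmd → State → ℕ → State → Prop
  | skip (σ : State) : Exec .skip σ 1 σ
  | store (a : ℕ) (i e : Expr) (σ : State) :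
      Exec (.store a i e) σ (i.time σ + e.time σ + len (i.val σ) + len (e.val σ))
        (σ.write a (i.val σ) (e.val σ))
  | seq {c₁ c₂ : Cmd} {σ σ₁ σ₂ : State} {t₁ t₂ : ℕ} :
      Exec c₁ σ t₁ σ₁ → Exec c₂ σ₁ t₂ σ₂ → Exec (.seq c₁ c₂) σ (t₁ + t₂) σ₂
  | ite_true {e : Expr} {c₁ c₂ : Cmd} {σ σ₁ : State} {t : ℕ} :
      e.val σ ≠ 0 → Exec c₁ σ t σ₁ → Exec (.ite e c₁ c₂) σ (e.time σ + len (e.val σ) + t) σ₁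
  | ite_false {e : Expr} {c₁ c₂ : Cmd} {σ σ₁ : State} {t : ℕ} :
      e.val σ = 0 → Exec c₂ σ t σ₁ → Exec (.ite e c₁ c₂) σ (e.time σ + len (e.val σ) + t) σ₁
  | while_true {e : Expr} {c : Cmd} {σ σ₁ σ₂ : State} {t₁ t₂ : ℕ} :
      e.val σ ≠ 0 → Exec c σ t₁ σ₁ → Exec (.while e c) σ₁ t₂ σ₂ →
        Exec (.while e c) σ (e.time σ + len (e.val σ) + t₁ + t₂) σ₂
  | while_false {e : Expr} {c : Cmd} {σ : State} :
      e.val σ = 0 → Exec (.while e c) σ (e.time σ + len (e.val σ)) σ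

/-- The size of a list of integers, each written in binary. -/
def size (x : List ℤ) : ℕ := (x.map len).sum

/-- The initial memory on input `x`: cell `0` of array `0` holds the length of `x`, the next cells
hold the entries of `x`, and all other cells hold `0`. -/
def init (x : List ℤ) : State := fun a i =>
  if a = 0 ∧ 0 ≤ i then ((x.length : ℤ) :: x).getD i.toNat 0 else 0

/-- The output: the list whose length is in cell `0` of array `1` and whose entries are in the next
cells. -/
def output (σ : State) : List ℤ :=
  List.ofFn fun j : Fin (σ 1 0).toNat => σ 1 ((j : ℤ) + 1)

/-- The search problem with instances in `ι`, encoded by `enc`, and with `Sol x y` for "`y` encodes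
a solution of the instance `x`" is solvable in polynomial time: one program finds a solution for
every instance, in time (including the time to print the output) at most a fixed polynomial in the
size of the encoded instance. -/
def PolyTimeSolvable {ι : Type} (enc : ι → List ℤ) (Sol : ι → List ℤ → Prop) : Prop :=
  ∃ (c : Cmd) (p : Polynomial ℕ), ∀ x : ι, ∃ (t : ℕ) (τ : State),
    Exec c (init (enc x)) t τ ∧ t + size (output τ) ≤ p.eval (size (enc x)) ∧ Sol x (output τ)

end RAM

/-! ## Soft repairing as a computational problem -/

namespace SoftRepair

/-- An instance of soft repairing: a database, given as a list of its facts in an arbitrary order,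
with the weights of its facts and of the functional dependencies. (Weights of other facts and of
functional dependencies that are not under consideration are irrelevant.) -/
structure Instance (k : ℕ) where
  facts : List (Fact k)
  nodup : facts.Nodup
  factWeight : Fact k → Weight
  fdWeight : FD k → Weight

/-- The database of an instance. -/
def Instance.database {k : ℕ} (I : Instance k) : Finset (Fact k) := I.facts.toFinset

/-- The encoding of an instance, for the functional dependencies `Δ`: the number of facts; the
weight (numerator, denominator) of each functional dependency; and the constants and the weight
(numerator, denominator) of each fact. -/
def Instance.encode {k : ℕ} (Δ : List (FD k)) (I : Instance k) : List ℤ :=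
  (I.facts.length : ℤ) ::
    (Δ.flatMap (fun φ => [(I.fdWeight φ).num, (I.fdWeight φ).den]) ++
      I.facts.flatMap (fun f =>
        (List.ofFn fun i => (f i : ℤ)) ++ [(I.factWeight f).num, (I.factWeight f).den]))

/-- `y` is the 0/1 characteristic vector of the subset `E` of the database, along the given list of
its facts. -/
def Instance.Encodes {k : ℕ} (I : Instance k) (y : List ℤ) (E : Finset (Fact k)) : Prop :=
  E ⊆ I.database ∧ y = I.facts.map fun f => if f ∈ E then 1 else 0

/-- Soft repairing for a schema with `k` attributes and the functional dependencies in `Δ` is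
solvable in polynomial time. -/
def SolvableInPolyTime (k : ℕ) (Δ : List (FD k)) : Prop :=
  RAM.PolyTimeSolvable (Instance.encode Δ) fun (I : Instance k) (y : List ℤ) =>
    ∃ E : Finset (Fact k), I.Encodes y E ∧
      IsOptimalSubset Δ.toFinset (fun f => (I.factWeight f).val) (fun φ => (I.fdWeight φ).val)
        I.database E

/-- The attribute `A` of the schema `R(A, B)`. -/
abbrev attrA : Fin 2 := 0

/-- The attribute `B` of the schema `R(A, B)`. -/
abbrev attrB : Fin 2 := 1

end SoftRepair

namespace RAM

/-! ### The length of integers -/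

/-! Two different facts that agree on one attribute disagree on the other. Hence the violations of
each dependency in `E` are exactly the pairs of facts of `E` with equal left-hand side (`card_vio`).
If `n` kept facts share a value, they contribute `0 + 1 + ... + (n - 1)` violations, a convex
function of `n`, so soft repairing is a minimum cost circulation problem with unit capacities. The
fact `(a, b)` is an arc from a node for `a` to a node for `b`, with cost minus its weight. The
ground node is joined to the node of `a` by one arc per fact with this value, of costs `0, w, 2w,
...`, and the nodes of the values `b` are joined back to the ground in the same way. A circulation
keeps the facts whose arcs carry flow. It pays at least for their violations (`mul_conflicts_le`),
and it pays exactly that if it uses the cheapest ground arcs (`groundFlow`). This gives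
`IsNetwork.keepCost_le`.

The circulation is found by inserting the arcs one at a time while maintaining a potential that
satisfies complementary slackness, which certifies optimality (`Certified.cost_le`). If the new arc
has negative reduced cost, a search of Dijkstra type starts from its head in the residual network
and looks for a path to its tail that is cheaper than the possible gain. If there is one, flow is
sent around the circuit; otherwise the new arc stays empty. In both cases the potential raised by
the truncated distances is a new certificate (`Search.certified_augment`, `Search.certified_keep`).
Each arc needs at most one augmentation, so the number of steps does not depend on the size of the
weights.

Rational weights become integers on multiplication by the squares of all denominators, a factor that
is positive whatever the signs (`scaled_eq`).

For the running time, the algorithm is a program whose loops are bounded by the length of the input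
and in which the right factor of every product is an input cell. An expression of such a program
lengthens the numbers in the memory only by a summand that depends on the input, so nested loops
lengthen them by a polynomial amount (`Tame.exists_polynomial`). -/

theorem len_le_of_natAbs_lt {z : ℤ} {b : ℕ} (h : z.natAbs < 2 ^ b) : len z ≤ b + 1 :=
  Nat.add_le_add_right (Nat.size_le.2 h) 1

theorem natAbs_lt_of_len_le {z : ℤ} {b : ℕ} (h : len z ≤ b + 1) : z.natAbs < 2 ^ b :=
  Nat.size_le.1 (Nat.le_of_add_le_add_right h)

theorem one_le_len (z : ℤ) : 1 ≤ len z := Nat.le_add_left 1 _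

theorem len_of_natAbs_le_max {x y z : ℤ} {b : ℕ} (hx : len x ≤ b) (hy : len y ≤ b)
    (h : z.natAbs ≤ x.natAbs + y.natAbs) : len z ≤ b + 1 := by
  obtain ⟨d, rfl⟩ : ∃ d, b = d + 1 := ⟨b - 1, by have := one_le_len x; omega⟩
  have hx := natAbs_lt_of_len_le hx
  have hy := natAbs_lt_of_len_le hy
  refine len_le_of_natAbs_lt ?_
  rw [pow_succ]
  omega

theorem len_mul_le (x y : ℤ) : len (x * y) ≤ len x + len y := by
  obtain ⟨b, hb⟩ : ∃ b, len x = b + 1 := ⟨_, rfl⟩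
  obtain ⟨d, hd⟩ : ∃ d, len y = d + 1 := ⟨_, rfl⟩
  have hx := natAbs_lt_of_len_le hb.le
  have hy := natAbs_lt_of_len_le hd.le
  rw [hb, hd]
  refine (len_le_of_natAbs_lt (b := b + d) ?_).trans (by omega)
  rw [Int.natAbs_mul, pow_add]
  exact Nat.mul_lt_mul'' hx hy

theorem len_natCast_le (n : ℕ) : len n ≤ n + 1 :=
  len_le_of_natAbs_lt (by simpa using n.lt_two_pow_self)

/-! ### Writing to the memory -/

@[simp]
theorem State.write_same (σ : State) (a : ℕ) (i z j : ℤ) :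
    σ.write a i z a j = if j = i then z else σ a j := by
  simp [State.write, Function.update_apply]

theorem State.write_same' (σ : State) (a : ℕ) (i z : ℤ) :
    σ.write a i z a = Function.update (σ a) i z := by
  simp [State.write]

@[simp]
theorem State.write_ne (σ : State) {a b : ℕ} (i z : ℤ) (h : b ≠ a) : σ.write a i z b = σ b := by
  simp [State.write, h]

/-! ### Programs with bounded loops -/

/-- Programs whose loops run through the numbers below the content of cell `0` of array `0`. The
counter of a loop is cell `0` of an array. -/
inductive LoopProg : Type
  | skip : LoopProg
  | store (a : ℕ) (i e : Expr) : LoopProg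
  | seq (c₁ c₂ : LoopProg) : LoopProg
  | ite (e : Expr) (c₁ c₂ : LoopProg) : LoopProg
  | loop (a : ℕ) (c : LoopProg) : LoopProg

namespace LoopProg

/-- The states at the beginning of the passes of a loop with counter `a` and body `f`. -/
def iter (a : ℕ) (f : State → State) (σ : State) : ℕ → State
  | 0 => σ.write a 0 0
  | t + 1 => (f (iter a f σ t)).write a 0 ((t : ℤ) + 1)

/-- The memory after a program has been executed. -/
def run : LoopProg → State → State
  | skip, σ => σ
  | store a i e, σ => σ.write a (i.val σ) (e.val σ)
  | seq c₁ c₂, σ => c₂.run (c₁.run σ)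
  | ite e c₁ c₂, σ => if e.val σ ≠ 0 then c₁.run σ else c₂.run σ
  | loop a c, σ => iter a c.run σ (σ 0 0).toNat

theorem run_store (a : ℕ) (i e : Expr) (σ : State) :
    (store a i e).run σ = σ.write a (i.val σ) (e.val σ) := rfl

theorem run_seq (c₁ c₂ : LoopProg) (σ : State) : (seq c₁ c₂).run σ = c₂.run (c₁.run σ) := rfl

theorem run_ite_of_ne_zero {e : Expr} {σ : State} (h : e.val σ ≠ 0) (c₁ c₂ : LoopProg) :
    (ite e c₁ c₂).run σ = c₁.run σ := if_pos h

theorem run_ite_of_eq_zero {e : Expr} {σ : State} (h : e.val σ = 0) (c₁ c₂ : LoopProg) :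
    (ite e c₁ c₂).run σ = c₂.run σ := if_neg (not_not.2 h)

/-- The arrays to which a program may write. -/
def writes : LoopProg → Finset ℕ
  | skip => ∅
  | store a _ _ => {a}
  | seq c₁ c₂ => c₁.writes ∪ c₂.writes
  | ite _ c₁ c₂ => c₁.writes ∪ c₂.writes
  | loop a c => insert a c.writes

/-- The translation into the language of random access machines. -/
def compile : LoopProg → Cmd
  | skip => .skip
  | store a i e => .store a i e
  | seq c₁ c₂ => .seq c₁.compile c₂.compile
  | ite e c₁ c₂ => .ite e c₁.compile c₂.compile
  | loop a c => .seq (.store a (.const 0) (.const 0))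
      (.while (.lt (.load a (.const 0)) (.load 0 (.const 0)))
        (.seq c.compile (.store a (.const 0) (.add (.load a (.const 0)) (.const 1)))))

end LoopProg

/-- The right factor of every product is a cell of array `0`. -/
def Expr.Tame : Expr → Prop
  | const _ => True
  | load _ e => e.Tame
  | add e₁ e₂ => e₁.Tame ∧ e₂.Tame
  | sub e₁ e₂ => e₁.Tame ∧ e₂.Tame
  | mul e₁ e₂ => e₁.Tame ∧ e₂.Tame ∧ ∃ i, e₂ = load 0 i
  | lt e₁ e₂ => e₁.Tame ∧ e₂.Tame
  | eq e₁ e₂ => e₁.Tame ∧ e₂.Tame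

namespace LoopProg

/-- All expressions are tame, array `0` is never changed, and the counter of a loop is not changed
by its body. -/
def Tame : LoopProg → Prop
  | skip => True
  | store a i e => a ≠ 0 ∧ i.Tame ∧ e.Tame
  | seq c₁ c₂ => c₁.Tame ∧ c₂.Tame
  | ite e c₁ c₂ => e.Tame ∧ c₁.Tame ∧ c₂.Tame
  | loop a c => a ≠ 0 ∧ a ∉ c.writes ∧ c.Tame

theorem iter_of_notMem {a b : ℕ} {f : State → State} (σ : State) (hb : b ≠ a)
    (hf : ∀ τ, f τ b = τ b) (t : ℕ) : iter a f σ t b = σ b := by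
  induction t with
  | zero => simp [iter, hb]
  | succ t ih => simp [iter, hb, hf, ih]

/-- The frame rule. Since `writes` is a computable finite set, its hypothesis can be settled by
`decide` or `simp` for concrete programs. -/
theorem run_of_notMem {c : LoopProg} {b : ℕ} (h : b ∉ c.writes) (σ : State) :
    c.run σ b = σ b := by
  induction c generalizing σ with
  | skip => rfl
  | store a i e =>
    simp only [writes, Finset.mem_singleton] at h
    simp [run, h]
  | seq c₁ c₂ h₁ h₂ =>
    simp only [writes, Finset.mem_union, not_or] at h
    simp [run, h₁ h.1, h₂ h.2]
  | ite e c₁ c₂ h₁ h₂ =>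
    simp only [writes, Finset.mem_union, not_or] at h
    simp only [run]
    split_ifs
    · exact h₁ h.1 σ
    · exact h₂ h.2 σ
  | loop a c hc =>
    simp only [writes, Finset.mem_insert, not_or] at h
    exact iter_of_notMem σ h.1 (hc h.2) _

theorem Tame.zero_notMem {c : LoopProg} (h : c.Tame) : 0 ∉ c.writes := by
  induction c with
  | skip => simp [writes]
  | store a i e => simpa [writes, eq_comm] using h.1
  | seq c₁ c₂ h₁ h₂ => simp [writes, h₁ h.1, h₂ h.2]
  | ite e c₁ c₂ h₁ h₂ => simp [writes, h₁ h.2.1, h₂ h.2.2]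
  | loop a c hc => simp [writes, hc h.2.2, h.1.symm]

/-- The counter of a loop at the beginning of a pass. -/
theorem iter_counter {a : ℕ} {f : State → State} (σ : State) (t : ℕ) : iter a f σ t a 0 = t := by
  cases t <;> simp [iter]

/-- The invariant rule for loops. -/
theorem run_loop {a : ℕ} {c : LoopProg} {σ : State} (Inv : ℕ → State → Prop) {m : ℕ}
    (hm : σ 0 0 = m) (zero : Inv 0 (σ.write a 0 0))
    (succ : ∀ t < m, ∀ τ : State, τ a 0 = t → (∀ b, b ≠ a → b ∉ c.writes → τ b = σ b) →
      Inv t τ → Inv (t + 1) ((c.run τ).write a 0 ((t : ℤ) + 1))) :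
    Inv m ((loop a c).run σ) := by
  have key : ∀ t ≤ m, Inv t (iter a c.run σ t) := by
    intro t
    induction t with
    | zero => exact fun _ => zero
    | succ t ih =>
      intro ht
      refine succ t ht _ (iter_counter σ t) (fun b hb hc => ?_) (ih (by omega))
      exact iter_of_notMem σ hb (run_of_notMem hc) t
  simpa [run, hm] using key m le_rfl

end LoopProg

/-! ### Programs with bounded loops run in polynomial time -/

/-- All contents of the memory have length at most `b`. -/
def State.Bounded (σ : State) (b : ℕ) : Prop := ∀ a i, len (σ a i) ≤ b

/-- A sum is at most one bit longer than the longer summand, and a product with an input cell is at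
most `n` bits longer than its left factor. So `b` enters the length bound with coefficient one; a
bound such as `2 * b` would grow exponentially under iteration. -/
theorem Expr.Tame.exists_bound {e : Expr} (he : e.Tame) :
    ∃ K : ℕ, ∀ (n b : ℕ) (σ : State), (∀ i, len (σ 0 i) ≤ n) → σ.Bounded b →
      len (e.val σ) ≤ b + K * (n + 1) ∧ e.time σ ≤ K * (b + K * (n + 1)) ^ 2 := by
  -- The common time bound for all operations: the last summand `s` is the sum of the lengths of the
  -- operands, or their product in the case of `mul`.
  have binop : ∀ {K₁ K₂ n b l₁ l₂ t₁ t₂ s : ℕ}, l₁ ≤ b + K₁ * (n + 1) → t₁ ≤ K₁ * (b + K₁ * (n + 1)) ^ 2 →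
      l₂ ≤ b + K₂ * (n + 1) → t₂ ≤ K₂ * (b + K₂ * (n + 1)) ^ 2 → s ≤ l₁ + l₂ ∨ s ≤ l₁ * l₂ →
      t₁ + t₂ + s ≤ (K₁ + K₂ + 2) * (b + (K₁ + K₂ + 2) * (n + 1)) ^ 2 := by
    intro K₁ K₂ n b l₁ l₂ t₁ t₂ s h₁ h₂ h₃ h₄ hs
    set X := b + (K₁ + K₂ + 2) * (n + 1) with hX
    have hX1 : 1 ≤ X := by rw [hX]; nlinarith
    have e₁ : b + K₁ * (n + 1) ≤ X := by rw [hX]; gcongr; omega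
    have e₂ : b + K₂ * (n + 1) ≤ X := by rw [hX]; gcongr; omega
    have f₁ : t₁ ≤ K₁ * X ^ 2 := h₂.trans (by gcongr)
    have f₂ : t₂ ≤ K₂ * X ^ 2 := h₄.trans (by gcongr)
    have f₃ : s ≤ 2 * X ^ 2 := by
      have l₁X := h₁.trans e₁
      have l₂X := h₃.trans e₂
      rcases hs with hs | hs
      · nlinarith
      · have := Nat.mul_le_mul l₁X l₂X
        nlinarith
    nlinarith
  have len01 : ∀ (p : Prop) [Decidable p] (b K n : ℕ), 1 ≤ b →
      len (if p then 1 else 0) ≤ b + (K + 2) * (n + 1) := by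
    intro p _ b K n hb
    have : len (if p then 1 else 0) ≤ 2 := by split_ifs <;> decide
    nlinarith [Nat.zero_le (K * (n + 1))]
  induction e with
  | const z =>
    refine ⟨len z, fun n b σ _ _ => ⟨?_, ?_⟩⟩
    · simp only [val]; nlinarith
    · simp only [time]
      have h1 : 1 ≤ b + len z * (n + 1) := by nlinarith [one_le_len z]
      exact Nat.le_mul_of_pos_right _ (by positivity)
  | load a e ih =>
    obtain ⟨K, hK⟩ := ih he
    refine ⟨K + 2, fun n b σ hn hb => ⟨(hb _ _).trans (Nat.le_add_right _ _), ?_⟩⟩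
    obtain ⟨h₁, h₂⟩ := hK n b σ hn hb
    -- A memory access is treated as a binary operation whose second operand is the loaded content,
    -- at no further evaluation time.
    have := binop (K₂ := 0) (t₂ := 0) (l₂ := len (σ a (e.val σ))) h₁ h₂
      ((hb _ _).trans (by omega)) (by simp) (Or.inl le_rfl)
    simpa [time, add_assoc] using this
  | add e₁ e₂ ih₁ ih₂ =>
    obtain ⟨K₁, hK₁⟩ := ih₁ he.1
    obtain ⟨K₂, hK₂⟩ := ih₂ he.2
    refine ⟨K₁ + K₂ + 2, fun n b σ hn hb => ?_⟩
    obtain ⟨h₁, h₂⟩ := hK₁ n b σ hn hb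
    obtain ⟨h₃, h₄⟩ := hK₂ n b σ hn hb
    refine ⟨?_, by simpa [time, add_assoc] using binop h₁ h₂ h₃ h₄ (Or.inl le_rfl)⟩
    refine (len_of_natAbs_le_max (b := b + (K₁ + K₂) * (n + 1)) (h₁.trans (by gcongr; omega))
      (h₃.trans (by gcongr; omega)) (Int.natAbs_add_le _ _)).trans (by nlinarith)
  | sub e₁ e₂ ih₁ ih₂ =>
    obtain ⟨K₁, hK₁⟩ := ih₁ he.1
    obtain ⟨K₂, hK₂⟩ := ih₂ he.2
    refine ⟨K₁ + K₂ + 2, fun n b σ hn hb => ?_⟩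
    obtain ⟨h₁, h₂⟩ := hK₁ n b σ hn hb
    obtain ⟨h₃, h₄⟩ := hK₂ n b σ hn hb
    refine ⟨?_, by simpa [time, add_assoc] using binop h₁ h₂ h₃ h₄ (Or.inl le_rfl)⟩
    refine (len_of_natAbs_le_max (b := b + (K₁ + K₂) * (n + 1)) (h₁.trans (by gcongr; omega))
      (h₃.trans (by gcongr; omega)) (Int.natAbs_sub_le _ _)).trans (by nlinarith)
  | mul e₁ e₂ ih₁ ih₂ =>
    obtain ⟨K₁, hK₁⟩ := ih₁ he.1
    obtain ⟨K₂, hK₂⟩ := ih₂ he.2.1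
    refine ⟨K₁ + K₂ + 2, fun n b σ hn hb => ?_⟩
    obtain ⟨h₁, h₂⟩ := hK₁ n b σ hn hb
    obtain ⟨h₃, h₄⟩ := hK₂ n b σ hn hb
    refine ⟨?_, by simpa [time, add_assoc] using binop h₁ h₂ h₃ h₄ (Or.inr le_rfl)⟩
    obtain ⟨i, rfl⟩ := he.2.2
    have := hn (i.val σ)
    refine (len_mul_le _ _).trans ?_
    simp only [val]
    nlinarith
  | lt e₁ e₂ ih₁ ih₂ =>
    obtain ⟨K₁, hK₁⟩ := ih₁ he.1
    obtain ⟨K₂, hK₂⟩ := ih₂ he.2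
    refine ⟨K₁ + K₂ + 2, fun n b σ hn hb => ?_⟩
    obtain ⟨h₁, h₂⟩ := hK₁ n b σ hn hb
    obtain ⟨h₃, h₄⟩ := hK₂ n b σ hn hb
    exact ⟨len01 _ _ _ _ ((one_le_len _).trans (hb 0 0)),
      by simpa [time, add_assoc] using binop h₁ h₂ h₃ h₄ (Or.inl le_rfl)⟩
  | eq e₁ e₂ ih₁ ih₂ =>
    obtain ⟨K₁, hK₁⟩ := ih₁ he.1
    obtain ⟨K₂, hK₂⟩ := ih₂ he.2
    refine ⟨K₁ + K₂ + 2, fun n b σ hn hb => ?_⟩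
    obtain ⟨h₁, h₂⟩ := hK₁ n b σ hn hb
    obtain ⟨h₃, h₄⟩ := hK₂ n b σ hn hb
    exact ⟨len01 _ _ _ _ ((one_le_len _).trans (hb 0 0)),
      by simpa [time, add_assoc] using binop h₁ h₂ h₃ h₄ (Or.inl le_rfl)⟩

theorem State.Bounded.write {σ : State} {b b' : ℕ} (h : σ.Bounded b) (hb : b ≤ b') (a : ℕ) (i : ℤ)
    {z : ℤ} (hz : len z ≤ b') : (σ.write a i z).Bounded b' := by
  intro a' i'
  by_cases ha : a' = a
  · subst ha
    rw [State.write_same]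
    split_ifs
    · exact hz
    · exact (h _ _).trans hb
  · rw [State.write_ne _ _ _ ha]
    exact (h _ _).trans hb

namespace LoopProg

/-- The program, started in a memory with contents of length at most `b` and an input of size at
most `n`, runs in time `T * (b + T) ^ 2` and lengthens the contents by at most `T`. -/
def RunsWithin (c : LoopProg) (T n : ℕ) : Prop :=
  ∀ (b : ℕ) (σ : State), (∀ i, len (σ 0 i) ≤ n) → (σ 0 0).toNat ≤ n → σ.Bounded b →
    (c.run σ).Bounded (b + T) ∧ ∃ t ≤ T * (b + T) ^ 2, Exec c.compile σ t (c.run σ)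

/-- Each pass adds at most `T` to the lengths, and `n + 1` leaves room for the counter, which never
exceeds `n`. -/
theorem bounded_iter {a : ℕ} {c : LoopProg} (hT : (loop a c).Tame) {T n : ℕ}
    (h : c.RunsWithin T n) {b : ℕ} {σ : State} (hn : ∀ i, len (σ 0 i) ≤ n)
    (hn' : (σ 0 0).toNat ≤ n) (hb : σ.Bounded b) (t : ℕ) (ht : t ≤ n) :
    (iter a c.run σ t).Bounded (b + n + 1 + t * T) := by
  have h0 : ∀ t, iter a c.run σ t 0 = σ 0 := fun t =>
    iter_of_notMem σ hT.1.symm (run_of_notMem hT.2.2.zero_notMem) t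
  induction t with
  | zero => exact hb.write (by omega) _ _ (by rw [show len 0 = 1 from rfl]; omega)
  | succ t ih =>
    have := (h _ _ (by rwa [h0]) (by rwa [h0]) (ih (by omega))).1
    refine this.write (by rw [add_mul]; omega) _ _ ?_
    have := len_natCast_le (t + 1)
    push_cast at this
    omega

/-- Induction on the number `j` of passes that remain, because `Exec.while_true` composes one pass
with the rest of the loop. The square of `b + n + 1 + n * T` bounds the body in every pass, and `20
+ 10 * n` covers the test and the increment of the counter. -/
theorem exec_while {a : ℕ} {c : LoopProg} (hT : (loop a c).Tame) {T n : ℕ}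
    (h : c.RunsWithin T n) {b : ℕ} {σ : State} (hn : ∀ i, len (σ 0 i) ≤ n)
    (hn' : (σ 0 0).toNat ≤ n) (hb : σ.Bounded b) (j : ℕ) (hj : j ≤ (σ 0 0).toNat) :
    ∃ t ≤ (j + 1) * ((T + 20 + 10 * n) * (b + n + 1 + n * T) ^ 2),
      Exec (.while (.lt (.load a (.const 0)) (.load 0 (.const 0)))
          (.seq c.compile (.store a (.const 0) (.add (.load a (.const 0)) (.const 1)))))
        (iter a c.run σ ((σ 0 0).toNat - j)) t (iter a c.run σ (σ 0 0).toNat) := by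
  set m := (σ 0 0).toNat with hm
  set X := b + n + 1 + n * T with hX
  have h0 : ∀ t, iter a c.run σ t 0 = σ 0 := fun t =>
    iter_of_notMem σ hT.1.symm (run_of_notMem hT.2.2.zero_notMem) t
  have hX1 : 1 ≤ X ^ 2 := Nat.one_le_pow _ _ (by omega)
  have hover : 20 + 10 * n ≤ (20 + 10 * n) * X ^ 2 := Nat.le_mul_of_pos_right _ hX1
  have c0 : len 0 = 1 := rfl
  have c1 : len 1 = 2 := rfl
  have hM := hn 0
  induction j with
  | zero =>
    have hv : (Expr.lt (.load a (.const 0)) (.load 0 (.const 0))).val (iter a c.run σ m) = 0 := by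
      simp only [Expr.val, iter_counter, h0]
      rw [if_neg (by omega)]
    refine ⟨_, ?_, by simpa using Exec.while_false hv⟩
    simp only [hv]
    simp only [Expr.time, Expr.val, iter_counter, h0, c0]
    have := len_natCast_le m
    nlinarith
  | succ j ih =>
    obtain ⟨t, ht, hE⟩ := ih (by omega)
    obtain ⟨s, hs⟩ : ∃ s, m - (j + 1) = s := ⟨_, rfl⟩
    have hs' : m - j = s + 1 := by omega
    have hsm : s < m := by omega
    rw [hs'] at hE
    rw [hs]
    have hv : (Expr.lt (.load a (.const 0)) (.load 0 (.const 0))).val (iter a c.run σ s) = 1 := by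
      simp only [Expr.val, iter_counter, h0]
      rw [if_pos (by omega)]
    obtain ⟨-, t', ht', hE'⟩ := h _ _ (by rwa [h0]) (by rwa [h0])
      (bounded_iter hT h hn hn' hb s (by omega))
    have hca : c.run (iter a c.run σ s) a 0 = s := by
      rw [run_of_notMem hT.2.1, iter_counter]
    have hst := Exec.store a (.const 0) (.add (.load a (.const 0)) (.const 1))
      (c.run (iter a c.run σ s))
    simp only [Expr.val, hca] at hst
    refine ⟨_, ?_, Exec.while_true (by rw [hv]; exact one_ne_zero) (.seq hE' hst) hE⟩
    rw [hv]
    simp only [Expr.time, Expr.val, iter_counter, h0, c0, c1, hca]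
    have l1 := len_natCast_le s
    have l2 := len_natCast_le (s + 1)
    push_cast at l2
    have e1 : b + n + 1 + s * T + T ≤ X := by
      have : (s + 1) * T ≤ n * T := Nat.mul_le_mul_right _ (by omega)
      rw [hX]; linarith
    have e2 : t' ≤ T * X ^ 2 := ht'.trans (by gcongr)
    have e3 : (j + 1 + 1) * ((T + 20 + 10 * n) * X ^ 2) =
      (j + 1) * ((T + 20 + 10 * n) * X ^ 2) + T * X ^ 2 + (20 + 10 * n) * X ^ 2 := by ring
    rw [e3]
    omega

/-- Bounds add up under composition, and a loop multiplies the bound by at most about `n`. Since `b`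
is quantified inside `RunsWithin`, the bound for the body applies to every pass although the
contents have grown in the meantime. -/
theorem Tame.exists_polynomial {c : LoopProg} (hc : c.Tame) :
    ∃ T : Polynomial ℕ, ∀ n, c.RunsWithin (T.eval n) n := by
  induction c with
  | skip =>
    refine ⟨1, fun n b σ _ _ hb => ⟨fun a i => (hb a i).trans (by simp), 1, ?_, .skip σ⟩⟩
    have : 1 ≤ (b + 1) ^ 2 := Nat.one_le_pow _ _ (by omega)
    simpa
  | store a i e =>
    obtain ⟨K, hK⟩ := hc.2.1.exists_bound
    obtain ⟨K', hK'⟩ := hc.2.2.exists_bound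
    refine ⟨Polynomial.C (K + K' + 2) * (Polynomial.X + 1), fun n b σ hn _ hb => ?_⟩
    obtain ⟨h₁, h₂⟩ := hK n b σ hn hb
    obtain ⟨h₃, h₄⟩ := hK' n b σ hn hb
    simp only [Polynomial.eval_mul, Polynomial.eval_C, Polynomial.eval_add, Polynomial.eval_X,
      Polynomial.eval_one]
    set X := b + (K + K' + 2) * (n + 1) with hX
    have e₁ : b + K * (n + 1) ≤ X := by rw [hX]; gcongr; omega
    have e₂ : b + K' * (n + 1) ≤ X := by rw [hX]; gcongr; omega
    refine ⟨hb.write (by omega) _ _ (h₃.trans e₂), _, ?_, .store a i e σ⟩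
    have f₁ : i.time σ ≤ K * X ^ 2 := h₂.trans (by gcongr)
    have f₂ : e.time σ ≤ K' * X ^ 2 := h₄.trans (by gcongr)
    have f₃ : X ≤ X ^ 2 := Nat.le_self_pow (by norm_num) _
    have f₄ : (K + K' + 2) * X ^ 2 ≤ (K + K' + 2) * (n + 1) * X ^ 2 := by
      gcongr
      exact Nat.le_mul_of_pos_right _ (by omega)
    nlinarith
  | seq c₁ c₂ ih₁ ih₂ =>
    obtain ⟨T₁, h₁⟩ := ih₁ hc.1
    obtain ⟨T₂, h₂⟩ := ih₂ hc.2
    refine ⟨T₁ + T₂, fun n b σ hn hn' hb => ?_⟩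
    have h0 : c₁.run σ 0 = σ 0 := run_of_notMem hc.1.zero_notMem σ
    obtain ⟨hb₁, t₁, ht₁, hE₁⟩ := h₁ n b σ hn hn' hb
    obtain ⟨hb₂, t₂, ht₂, hE₂⟩ := h₂ n _ (c₁.run σ) (by rwa [h0]) (by rwa [h0]) hb₁
    rw [Polynomial.eval_add]
    refine ⟨by rwa [← add_assoc], _, ?_, .seq hE₁ hE₂⟩
    calc t₁ + t₂ ≤ T₁.eval n * (b + T₁.eval n) ^ 2 +
          T₂.eval n * (b + T₁.eval n + T₂.eval n) ^ 2 := by gcongr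
      _ ≤ T₁.eval n * (b + T₁.eval n + T₂.eval n) ^ 2 +
          T₂.eval n * (b + T₁.eval n + T₂.eval n) ^ 2 :=
        Nat.add_le_add_right
          (Nat.mul_le_mul_left _ (Nat.pow_le_pow_left (Nat.le_add_right _ _) _)) _
      _ = _ := by ring
  | ite e c₁ c₂ ih₁ ih₂ =>
    obtain ⟨K, hK⟩ := hc.1.exists_bound
    obtain ⟨T₁, h₁⟩ := ih₁ hc.2.1
    obtain ⟨T₂, h₂⟩ := ih₂ hc.2.2
    refine ⟨Polynomial.C (K + 1) * (Polynomial.X + 1) + T₁ + T₂, fun n b σ hn hn' hb => ?_⟩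
    obtain ⟨hl, ht⟩ := hK n b σ hn hb
    simp only [Polynomial.eval_mul, Polynomial.eval_C, Polynomial.eval_add, Polynomial.eval_X,
      Polynomial.eval_one]
    set T := (K + 1) * (n + 1) + T₁.eval n + T₂.eval n with hT
    have e₀ : b + K * (n + 1) ≤ b + T := by rw [hT]; nlinarith
    have e₁ : e.time σ ≤ K * (b + T) ^ 2 := ht.trans (by gcongr)
    have e₂ : len (e.val σ) ≤ (b + T) ^ 2 :=
      (hl.trans e₀).trans (Nat.le_self_pow (by norm_num) _)
    have e₃ : (K + 1) * (b + T) ^ 2 ≤ (K + 1) * (n + 1) * (b + T) ^ 2 := by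
      gcongr
      exact Nat.le_mul_of_pos_right _ (by omega)
    have e₄ : T * (b + T) ^ 2 = (K + 1) * (n + 1) * (b + T) ^ 2 + T₁.eval n * (b + T) ^ 2 +
      T₂.eval n * (b + T) ^ 2 := by rw [← add_mul, ← add_mul]
    by_cases hv : e.val σ = 0
    · obtain ⟨hb₂, t₂, ht₂, hE₂⟩ := h₂ n b σ hn hn' hb
      simp only [run, hv, ne_eq, not_true_eq_false, if_false]
      refine ⟨fun a i => (hb₂ a i).trans (by omega), _, ?_, .ite_false hv hE₂⟩
      have : t₂ ≤ T₂.eval n * (b + T) ^ 2 := ht₂.trans (by gcongr; omega)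
      rw [e₄]
      nlinarith
    · obtain ⟨hb₁, t₁, ht₁, hE₁⟩ := h₁ n b σ hn hn' hb
      simp only [run, hv, ne_eq, not_false_eq_true, if_true]
      refine ⟨fun a i => (hb₁ a i).trans (by omega), _, ?_, .ite_true hv hE₁⟩
      have : t₁ ≤ T₁.eval n * (b + T) ^ 2 := ht₁.trans (by gcongr; omega)
      rw [e₄]
      nlinarith
  | loop a c ih =>
    obtain ⟨T₁, h₁⟩ := ih hc.2.2
    -- There are at most `n` passes and one last test; `10 * n + 24` absorbs the tests, the
    -- increments and the initialization of the counter.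
    refine ⟨(Polynomial.X + 1) * (T₁ + Polynomial.C 10 * Polynomial.X + Polynomial.C 24),
      fun n b σ hn hn' hb => ?_⟩
    simp only [Polynomial.eval_mul, Polynomial.eval_C, Polynomial.eval_add, Polynomial.eval_X,
      Polynomial.eval_one]
    set m := (σ 0 0).toNat with hm
    set T := T₁.eval n
    have hle : b + n + 1 + n * T ≤ b + (n + 1) * (T + 10 * n + 24) := by nlinarith
    refine ⟨fun x y => (bounded_iter hc (h₁ n) hn hn' hb m hn' x y).trans (le_trans ?_ hle), ?_⟩
    · gcongr
    · obtain ⟨t, ht, hE⟩ := exec_while hc (h₁ n) hn hn' hb m le_rfl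
      rw [← hm, Nat.sub_self] at hE
      refine ⟨_, ?_, .seq (.store a (.const 0) (.const 0) σ) hE⟩
      simp only [Expr.time, Expr.val, show len 0 = 1 from rfl]
      set Y := b + (n + 1) * (T + 10 * n + 24)
      have hY : 1 ≤ Y ^ 2 := Nat.one_le_pow _ _ (by nlinarith)
      have h3 : t ≤ (n + 1) * ((T + 20 + 10 * n) * Y ^ 2) := ht.trans (by gcongr)
      have h4 : (n + 1) * (T + 10 * n + 24) * Y ^ 2 =
        (n + 1) * ((T + 20 + 10 * n) * Y ^ 2) + (n + 1) * (4 * Y ^ 2) := by ring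
      have h5 : 4 ≤ (n + 1) * (4 * Y ^ 2) := by nlinarith
      rw [h4]
      omega

end LoopProg

theorem length_le_size (x : List ℤ) : x.length ≤ size x := by
  induction x with
  | nil => simp
  | cons z x ih =>
    have := one_le_len z
    simp only [size, List.map_cons, List.sum_cons, List.length_cons] at ih ⊢
    omega

theorem len_le_size {x : List ℤ} {z : ℤ} (hz : z ∈ x) : len z ≤ size x :=
  List.le_sum_of_mem (List.mem_map_of_mem hz)

theorem init_bounded (x : List ℤ) : (init x).Bounded (size x + 1) := by
  intro a i
  unfold init
  split_ifs
  · rcases lt_or_ge i.toNat ((x.length : ℤ) :: x).length with h | h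
    · rw [List.getD_eq_getElem _ _ h]
      rcases List.mem_cons.1 (List.getElem_mem h) with h | h
      · rw [h]
        have := len_natCast_le x.length
        have := length_le_size x
        omega
      · exact (len_le_size h).trans (Nat.le_succ _)
    · rw [List.getD_eq_default _ _ h]
      exact Nat.le_add_left _ _
  · exact Nat.le_add_left _ _

/-- A search problem is solvable in polynomial time if it is solved by a program with bounded
loops, with output of polynomial size. -/
theorem polyTimeSolvable_of_loopProg {ι : Type} {enc : ι → List ℤ} {Sol : ι → List ℤ → Prop}
    (c : LoopProg) (hc : c.Tame) (q : Polynomial ℕ)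
    (h : ∀ x, Sol x (output (c.run (init (enc x)))))
    (hq : ∀ x, size (output (c.run (init (enc x)))) ≤ q.eval (size (enc x))) :
    PolyTimeSolvable enc Sol := by
  obtain ⟨T, hT⟩ := hc.exists_polynomial
  -- Cell `0` holds the number of entries, so the initial contents are bounded by the size plus one;
  -- `RunsWithin` is used with `b` and `n` both equal to this number.
  refine ⟨c.compile, (T * (Polynomial.X + T) ^ 2).comp (Polynomial.X + 1) + q, fun x => ?_⟩
  have hl := length_le_size (enc x)
  obtain ⟨-, t, ht, hE⟩ := hT (size (enc x) + 1) _ (init (enc x))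
    (fun i => init_bounded _ 0 i) (by simp [init]; omega) (init_bounded _)
  refine ⟨t, _, hE, ?_, h x⟩
  rw [Polynomial.eval_add]
  refine add_le_add (ht.trans (le_of_eq ?_)) (hq x)
  simp [Polynomial.eval_comp]

end RAM

/-! ### Circulations of minimal cost in networks with unit capacities

The arcs are numbered; arc `i` leads from `T i` to `H i` and costs `C i`. -/

namespace UnitFlow

/-- Complementary slackness for an arc with flow `ξ` and reduced cost `r`. -/
def Fits (ξ r : ℤ) : Prop := (ξ = 0 ∧ 0 ≤ r) ∨ (ξ = 1 ∧ r ≤ 0)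

/-- The reduced cost of an arc with respect to a potential. -/
def reducedCost (T H C π : ℤ → ℤ) (i : ℤ) : ℤ := C i + π (T i) - π (H i)

/-- The total change of `φ` along the flow `x` on the first `k` arcs. -/
def change (T H x : ℤ → ℤ) (k : ℕ) (φ : ℤ → ℤ) : ℤ :=
  ∑ i ∈ Finset.range k, x i * (φ (H i) - φ (T i))

/-- `x` is a circulation on the first `k` arcs and `π` is a potential that certifies that its cost
is minimal. -/
def Certified (T H C : ℤ → ℤ) (k : ℕ) (x π : ℤ → ℤ) : Prop :=
  (∀ i : ℕ, i < k → Fits (x i) (reducedCost T H C π i)) ∧ ∀ φ, change T H x k φ = 0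

theorem Fits.eq_zero_or_one {ξ r : ℤ} (h : Fits ξ r) : ξ = 0 ∨ ξ = 1 := h.imp And.left And.left

/-- Weak duality: on circulations cost and reduced cost agree, and a flow that fits the potential
minimizes the reduced cost on every arc separately. -/
theorem Certified.cost_le {T H C x π : ℤ → ℤ} {k : ℕ} (h : Certified T H C k x π) {x' : ℤ → ℤ}
    (hx' : ∀ i : ℕ, i < k → x' i = 0 ∨ x' i = 1) (hc : ∀ φ, change T H x' k φ = 0) :
    ∑ i ∈ Finset.range k, C i * x i ≤ ∑ i ∈ Finset.range k, C i * x' i := by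
  have key : ∀ y : ℤ → ℤ, change T H y k π = 0 → ∑ i ∈ Finset.range k, C i * y i =
      ∑ i ∈ Finset.range k, reducedCost T H C π i * y i := by
    intro y hy
    rw [← sub_eq_zero, ← Finset.sum_sub_distrib, ← hy, change]
    refine Finset.sum_congr rfl fun i _ => ?_
    simp only [reducedCost]
    ring
  rw [key x (h.2 π), key x' (hc π)]
  refine Finset.sum_le_sum fun i hi => ?_
  rw [Finset.mem_range] at hi
  rcases h.1 i hi with ⟨h₁, h₂⟩ | ⟨h₁, h₂⟩ <;> rcases hx' i hi with h₃ | h₃ <;> rw [h₁, h₃] <;>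
    linarith

/-! ### Cheapest paths in the residual network -/

/-- The origin of an arc of the residual network. -/
def resTail (T H x : ℤ → ℤ) (i : ℤ) : ℤ := if x i = 0 then T i else H i

/-- The target of an arc of the residual network. -/
def resHead (T H x : ℤ → ℤ) (i : ℤ) : ℤ := if x i = 0 then H i else T i

/-- The reduced cost of an arc of the residual network. -/
def resCost (T H C x π : ℤ → ℤ) (i : ℤ) : ℤ :=
  if x i = 0 then C i + π (T i) - π (H i) else π (H i) - π (T i) - C i

/-- An arc of the residual network that leaves the set of marked nodes. -/
def Crossing (T H x m : ℤ → ℤ) (i : ℤ) : Prop := m (resTail T H x i) ≠ 0 ∧ m (resHead T H x i) = 0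

/-- The potential in which all unmarked nodes are raised by `Δ`. -/
def raised (π m : ℤ → ℤ) (Δ : ℤ) (w : ℤ) : ℤ := π w + if m w = 0 then Δ else 0

/-- The invariant of the search for cheapest paths in the residual network of the flow `x` from the
node `v` to the marked nodes `w`; flow `y w` arises from `x` by augmentation along such a path. -/
structure Search (T H C x : ℤ → ℤ) (k : ℕ) (v cap : ℤ) (π₀ π m : ℤ → ℤ) (Δ : ℤ) (y : ℤ → ℤ → ℤ) :
    Prop where
  fits : ∀ i : ℕ, i < k → Fits (x i) (reducedCost T H C (raised π m Δ) i)
  root : m v ≠ 0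
  pot_root : π v = π₀ v
  pot_eq : ∀ w, m w = 0 → π w = π₀ w
  path : ∀ w, m w ≠ 0 → ∀ φ, change T H (y w) k φ = φ w - φ v
  tree : ∀ w, m w ≠ 0 → ∀ i : ℕ, i < k → y w i = x i ∨
    (m (T i) ≠ 0 ∧ m (H i) ≠ 0 ∧ Fits (y w i) (reducedCost T H C π i))
  nonneg : 0 ≤ Δ
  le_cap : Δ ≤ cap
  le_pot : ∀ w, π₀ w ≤ raised π m Δ w
  pot_le : ∀ w, raised π m Δ w ≤ π₀ w + Δ

variable {T H C x : ℤ → ℤ} {k : ℕ} {v cap : ℤ} {π₀ π m : ℤ → ℤ} {Δ : ℤ} {y : ℤ → ℤ → ℤ}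

/-- The residual cost of a crossing arc in the raised potential is its residual cost in `π` minus
`Δ`, and it is nonnegative because the flow fits. Hence the successive raises never decrease. -/
theorem Search.le_resCost (h : Search T H C x k v cap π₀ π m Δ y) {i : ℕ} (hi : i < k)
    (hc : Crossing T H x m i) : Δ ≤ resCost T H C x π i := by
  obtain ⟨h₁, h₂⟩ := hc
  rcases h.fits i hi with ⟨hx, hr⟩ | ⟨hx, hr⟩ <;>
    simp only [reducedCost, raised, resTail, resHead, resCost, hx, if_true, one_ne_zero, if_false]
      at * <;> simp only [h₁, h₂, if_true, if_false] at hr <;> linarith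

/-- A further raise of the unmarked nodes lowers the residual cost of crossing arcs only. Residual
arcs that enter the marked set become more expensive, and all others are unaffected. -/
theorem Search.raise (h : Search T H C x k v cap π₀ π m Δ y) {Δ' : ℤ} (h₁ : Δ ≤ Δ') (h₂ : Δ' ≤ cap)
    (h₃ : ∀ i : ℕ, i < k → Crossing T H x m i → Δ' ≤ resCost T H C x π i) :
    Search T H C x k v cap π₀ π m Δ' y where
  fits i hi := by
    have hf := h.fits i hi
    have hc := h₃ i hi
    rcases hf with ⟨hx, hr⟩ | ⟨hx, hr⟩
    · refine Or.inl ⟨hx, ?_⟩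
      simp only [reducedCost, raised, resTail, resHead, resCost, Crossing, hx, if_true] at *
      by_cases ht : m (T i) = 0 <;> by_cases hh : m (H i) = 0 <;> simp [ht, hh] at hr hc ⊢ <;>
        linarith
    · refine Or.inr ⟨hx, ?_⟩
      simp only [reducedCost, raised, resTail, resHead, resCost, Crossing, hx, one_ne_zero,
        if_false] at *
      by_cases ht : m (T i) = 0 <;> by_cases hh : m (H i) = 0 <;> simp [ht, hh] at hr hc ⊢ <;>
        linarith
  root := h.root
  pot_root := h.pot_root
  pot_eq := h.pot_eq
  path := h.path
  tree := h.tree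
  nonneg := h.nonneg.trans h₁
  le_cap := h₂
  le_pot w := (h.le_pot w).trans (by unfold raised; split_ifs <;> linarith)
  pot_le w := by
    have := h.pot_le w
    unfold raised at *
    split_ifs at * <;> linarith

theorem Certified.search (h : Certified T H C k x π) (hcap : 0 ≤ cap)
    (hm : ∀ w, m w ≠ 0 ↔ w = v) (hy : ∀ i : ℕ, i < k → y v i = x i) :
    Search T H C x k v cap π π m 0 y where
  fits i hi := by simpa [reducedCost, raised] using h.1 i hi
  root := (hm v).2 rfl
  pot_root := rfl
  pot_eq _ _ := rfl
  path w hw φ := by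
    rw [(hm w).1 hw, sub_self, ← h.2 φ]
    exact Finset.sum_congr rfl fun i hi => by rw [hy i (Finset.mem_range.1 hi)]
  tree w hw i hi := Or.inl (by rw [(hm w).1 hw, hy i hi])
  nonneg := le_rfl
  le_cap := hcap
  le_pot w := by simp [raised]
  pot_le w := by simp [raised]

/-- Marking a node while fixing its raised value as its potential does not change the raised
potential, so the certificate survives. -/
theorem raised_update {b : ℤ} (hb : m b = 0) :
    raised (Function.update π b (π b + Δ)) (Function.update m b 1) Δ = raised π m Δ := by
  funext w
  by_cases hw : w = b
  · subst hw; simp [raised, hb]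
  · simp [raised, hw]

/-- A crossing arc of residual cost `Δ` is tight in the raised potential, so complementary slackness
allows either flow on it. The path to its head is the path to its tail followed by this arc. -/
theorem Search.mark (h : Search T H C x k v cap π₀ π m Δ y) {j : ℕ} (hj : j < k)
    (hc : Crossing T H x m j) (hΔ : resCost T H C x π j = Δ) {b : ℤ} (hb : resHead T H x j = b)
    {y' : ℤ → ℤ → ℤ} (hy : ∀ w, m w ≠ 0 → ∀ i : ℕ, i < k → y' w i = y w i)
    (hyb : ∀ i : ℕ, i < k → i ≠ j → y' b i = y (resTail T H x j) i) (hyj : y' b j = 1 - x j) :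
    Search T H C x k v cap π₀ (Function.update π b (π b + Δ)) (Function.update m b 1) Δ y' := by
  have hmb : m b = 0 := hb ▸ hc.2
  have hr := raised_update (π := π) (Δ := Δ) hmb
  have hne : ∀ {w}, m w ≠ 0 → w ≠ b := fun hw e => hw (e ▸ hmb)
  have hm : ∀ {w}, m w ≠ 0 → Function.update m b 1 w ≠ 0 := fun hw => by simp [hne hw, hw]
  have hm' : ∀ {w}, Function.update m b 1 w ≠ 0 → m w ≠ 0 ∨ w = b := fun {w} hw => by
    by_cases e : w = b
    · exact Or.inr e
    · exact Or.inl (by simpa [e] using hw)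
  have hrc : ∀ i, m (T i) ≠ 0 → m (H i) ≠ 0 →
      reducedCost T H C (Function.update π b (π b + Δ)) i = reducedCost T H C π i := by
    intro i h₁ h₂
    simp [reducedCost, hne h₁, hne h₂]
  have tree_old : ∀ w, m w ≠ 0 → ∀ i : ℕ, i < k → y w i = x i ∨
      (Function.update m b 1 (T i) ≠ 0 ∧ Function.update m b 1 (H i) ≠ 0 ∧
        Fits (y w i) (reducedCost T H C (Function.update π b (π b + Δ)) i)) := by
    intro w hw i hi
    rcases h.tree w hw i hi with h₁ | ⟨h₁, h₂, h₃⟩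
    · exact Or.inl h₁
    · exact Or.inr ⟨hm h₁, hm h₂, by rwa [hrc i h₁ h₂]⟩
  have hx : x j = 0 ∨ x j = 1 := (h.fits j hj).eq_zero_or_one
  -- Augmentations so far change only arcs with both ends marked, and one end of arc `j` is
  -- unmarked.
  have hyx : y (resTail T H x j) j = x j := by
    rcases h.tree _ hc.1 j hj with h₁ | ⟨h₁, h₂, -⟩
    · exact h₁
    · have := hc.2
      unfold resHead at this
      split_ifs at this <;> contradiction
  have hrc0 : reducedCost T H C (raised π m Δ) j = 0 := by
    obtain ⟨h₁, h₂⟩ := hc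
    rcases hx with hx | hx <;>
      simp only [reducedCost, raised, resTail, resHead, resCost, hx, if_true, one_ne_zero,
        if_false] at * <;> simp only [h₁, h₂, if_true, if_false] <;> linarith
  have hends : Function.update m b 1 (T j) ≠ 0 ∧ Function.update m b 1 (H j) ≠ 0 := by
    obtain ⟨h₁, -⟩ := hc
    rcases hx with hx | hx <;>
      simp only [resTail, resHead, hx, if_true, one_ne_zero, if_false] at h₁ hb
    · exact ⟨hm h₁, by simp [hb]⟩
    · exact ⟨by simp [hb], hm h₁⟩
  refine ⟨by rw [hr]; exact h.fits, hm h.root, ?_, ?_, ?_, ?_, h.nonneg, h.le_cap,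
    by rw [hr]; exact h.le_pot, by rw [hr]; exact h.pot_le⟩
  · rw [Function.update_of_ne (hne h.root), h.pot_root]
  · intro w hw
    have hwb : w ≠ b := fun e => by simp [e] at hw
    rw [Function.update_of_ne hwb] at hw ⊢
    exact h.pot_eq w hw
  · intro w hw φ
    have hold : ∀ w, m w ≠ 0 → change T H (y' w) k φ = φ w - φ v := by
      intro w hw
      rw [← h.path w hw φ]
      exact Finset.sum_congr rfl fun i hi => by rw [hy w hw i (Finset.mem_range.1 hi)]
    rcases hm' hw with hw | rfl
    · exact hold w hw
    -- Arc `j` is split off the sum: reversing its flow adds the difference of `φ` between its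
    -- residual head and tail.
    · have := h.path _ hc.1 φ
      unfold change at *
      rw [← Finset.add_sum_erase _ _ (Finset.mem_range.2 hj)] at this ⊢
      rw [Finset.sum_congr rfl (g := fun i : ℕ => y (resTail T H x j) i * (φ (H i) - φ (T i)))]
      · rw [hyj]
        rw [hyx] at this
        rw [← hb]
        rcases hx with hx | hx <;>
          simp only [resTail, resHead, hx, if_true, one_ne_zero, if_false] at this ⊢ <;> linarith
      · intro i hi
        rw [Finset.mem_erase, Finset.mem_range] at hi
        rw [hyb i hi.2 hi.1]
  · intro w hw i hi
    rcases hm' hw with hw | rfl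
    · rw [hy w hw i hi]
      exact tree_old w hw i hi
    · by_cases hij : i = j
      · subst hij
        refine Or.inr ⟨hends.1, hends.2, ?_⟩
        -- Both ends of arc `j` are marked now, so its reduced cost is the one in the raised
        -- potential, which vanishes.
        have : reducedCost T H C (Function.update π w (π w + Δ)) i =
            reducedCost T H C (raised π m Δ) i := by
          rw [← hr]
          simp [reducedCost, raised, hends.1, hends.2]
        rw [this, hrc0, hyj]
        rcases hx with hx | hx <;> rw [hx]
        · exact Or.inr ⟨by norm_num, le_rfl⟩
        · exact Or.inl ⟨by norm_num, le_rfl⟩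
      · rw [hyb i hi hij]
        exact tree_old _ hc.1 i hi

/-- The new arc closes the path from its head to its tail to a circuit. Its tail has been raised by
at most `cap`, which is minus its old reduced cost, while its head is not raised; so its reduced
cost is at most zero, as flow `1` requires. -/
theorem Search.certified_augment (h : Search T H C x k (H k) cap π₀ π m Δ y)
    (hcap : cap = max 0 (-reducedCost T H C π₀ k)) (hpos : 0 < cap) (hm : m (T k) ≠ 0)
    {x' : ℤ → ℤ} (hx' : ∀ i : ℕ, i < k → x' i = y (T k) i) (hk : x' k = 1) :
    Certified T H C (k + 1) x' (raised π m Δ) := by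
  constructor
  · intro i hi
    rcases Nat.lt_succ_iff_lt_or_eq.1 hi with hi | rfl
    · rw [hx' i hi]
      rcases h.tree _ hm i hi with h₁ | ⟨h₁, h₂, h₃⟩
      · rw [h₁]
        exact h.fits i hi
      · have : reducedCost T H C (raised π m Δ) i = reducedCost T H C π i := by
          simp [reducedCost, raised, h₁, h₂]
        rwa [this]
    · refine Or.inr ⟨hk, ?_⟩
      have h₁ := h.pot_le (T i)
      have h₂ := h.le_cap
      have h₃ := h.pot_root
      have h₄ := h.root
      have h₅ : cap = -reducedCost T H C π₀ i := by
        rw [hcap] at hpos ⊢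
        exact max_eq_right ((lt_max_iff.1 hpos).resolve_left (lt_irrefl _)).le
      simp only [reducedCost, raised, h₄, hm, if_false] at *
      linarith
  · intro φ
    have := h.path _ hm φ
    unfold change at *
    rw [Finset.sum_range_succ, hk, Finset.sum_congr rfl fun i hi => by
      rw [hx' i (Finset.mem_range.1 hi)], this]
    ring

/-- Flow `0` needs a nonnegative reduced cost. Either this held before, and raising the tail
preserves it, or the tail was not reached and has been raised by the full violation `cap`. -/
theorem Search.certified_keep (h : Search T H C x k (H k) cap π₀ π m Δ y)
    (hcap : cap = max 0 (-reducedCost T H C π₀ k)) (hm : cap ≤ 0 ∨ m (T k) = 0 ∧ Δ = cap)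
    (hc : ∀ φ, change T H x k φ = 0)
    {x' : ℤ → ℤ} (hx' : ∀ i : ℕ, i < k → x' i = x i) (hk : x' k = 0) :
    Certified T H C (k + 1) x' (raised π m Δ) := by
  constructor
  · intro i hi
    rcases Nat.lt_succ_iff_lt_or_eq.1 hi with hi | rfl
    · rw [hx' i hi]
      exact h.fits i hi
    · refine Or.inl ⟨hk, ?_⟩
      have h₁ := h.le_pot (T i)
      have h₂ : -reducedCost T H C π₀ i ≤ cap := hcap ▸ le_max_right _ _
      have h₃ := h.pot_root
      have h₄ := h.root
      have h₅ := h.pot_le (T i)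
      rcases hm with hm | ⟨hm, rfl⟩
      · simp only [reducedCost, raised, h₄, if_false] at *
        linarith
      · have : raised π m Δ (T i) = π₀ (T i) + Δ := by
          simp [raised, hm, h.pot_eq _ hm]
        simp only [reducedCost, this] at *
        simp only [raised, h₄, if_false] at *
        linarith
  · intro φ
    have := hc φ
    unfold change at *
    rw [Finset.sum_range_succ, hk, Finset.sum_congr rfl fun i hi => by
      rw [hx' i (Finset.mem_range.1 hi)], this]
    ring

end UnitFlow

/-! ### A program for circulations of minimal cost

The arrays are used as follows: `2`, `3`, `4` origins, targets and costs of the arcs; `5` flow;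
`6` potential; `7` marks of the nodes that have been reached; `8` flows of the augmentations, for
all nodes; `9` raise of the potential of the unmarked nodes; `10` its upper bound; `11` to `17`
scalars; `20`, `21`, `22` counters. The number of arcs is cell `0` of array `0`. -/

namespace UnitFlow

open RAM RAM.LoopProg

/-- The scalar kept in cell `0` of an array. -/
abbrev var (a : ℕ) : Expr := .load a (.const 0)

infixr:60 " ;; " => LoopProg.seq

/-- Copies a block of length `σ 0 0`, from `q` in array `s` to `p` in array `d`. -/
def copyBlock (d : ℕ) (p : Expr) (s : ℕ) (q : Expr) : LoopProg :=
  .loop 22 (.store d (.add p (var 22)) (.load s (.add q (var 22))))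

/-- The addresses `p` and `q` are evaluated anew in every pass, so their values must not depend on
the counter or on array `d`. Within one array the blocks must be disjoint, lest a source cell be
overwritten before it is read. -/
theorem run_copyBlock {d s : ℕ} {p q : Expr} (hd : d ≠ 22) (hs : s ≠ 22) {σ : State}
    {P Q : ℤ} {M : ℕ} (hM : σ 0 0 = M)
    (hp : ∀ τ : State, (∀ b, b ≠ 22 → b ≠ d → τ b = σ b) → p.val τ = P)
    (hq : ∀ τ : State, (∀ b, b ≠ 22 → b ≠ d → τ b = σ b) → q.val τ = Q)
    (hsd : s = d → ∀ i < M, ∀ i' < M, Q + (i : ℕ) ≠ P + (i' : ℕ)) :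
    (∀ i : ℕ, i < M → (copyBlock d p s q).run σ d (P + i) = σ s (Q + i)) ∧
      ∀ j, (∀ i : ℕ, i < M → j ≠ P + i) → (copyBlock d p s q).run σ d j = σ d j := by
  refine run_loop (fun t τ => (∀ i : ℕ, i < t → τ d (P + i) = σ s (Q + i)) ∧
    ∀ j, (∀ i : ℕ, i < t → j ≠ P + i) → τ d j = σ d j) hM ?_ ?_
  · simp [hd]
  · intro t ht τ hτ hframe ⟨h₁, h₂⟩
    have hf : ∀ b, b ≠ 22 → b ≠ d → τ b = σ b := fun b h h' => hframe b h (by simpa [writes] using h')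
    have hsrc : τ s (Q + t) = σ s (Q + t) := by
      by_cases e : s = d
      · rw [e]
        exact h₂ _ fun i hi => hsd e t ht i (by omega)
      · rw [hf s hs e]
    simp only [run, Expr.val, hp τ hf, hq τ hf, hτ, ne_eq, hd, not_false_eq_true,
      State.write_ne, State.write_same, hsrc]
    refine ⟨fun i hi => ?_, fun j hj => ?_⟩
    · rcases Nat.lt_succ_iff_lt_or_eq.1 hi with hi | rfl
      · rw [if_neg (by omega), h₁ i hi]
      · simp
    · rw [if_neg (hj t (by omega))]
      exact h₂ j fun i hi => hj i (by omega)

/-- One step of the search for a cheapest arc that leaves the set of marked nodes. -/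
def compareArc : LoopProg :=
  .ite (.lt (var 22) (var 20))
    (.ite (.load 5 (var 22))
      (.store 13 (.const 0) (.load 3 (var 22)) ;; .store 14 (.const 0) (.load 2 (var 22)) ;;
        .store 15 (.const 0) (.sub (.sub (.load 6 (var 13)) (.load 6 (var 14)))
          (.load 4 (var 22))))
      (.store 13 (.const 0) (.load 2 (var 22)) ;; .store 14 (.const 0) (.load 3 (var 22)) ;;
        .store 15 (.const 0) (.sub (.add (.load 4 (var 22)) (.load 6 (var 13)))
          (.load 6 (var 14)))) ;;
    .ite (.load 7 (var 13))
      (.ite (.load 7 (var 14)) .skip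
        (.ite (.lt (var 15) (var 11))
          (.store 11 (.const 0) (var 15) ;; .store 12 (.const 0) (var 22) ;;
            .store 16 (.const 0) (var 13) ;; .store 17 (.const 0) (var 14))
          .skip))
      .skip)
    .skip

/-- The result of the comparison of the first `t` arcs. -/
def BestArc (T H C x π m : ℤ → ℤ) (cap : ℤ) (k t : ℕ) (τ : State) : Prop :=
  τ 11 0 ≤ cap ∧
  (τ 12 0 = -1 ∧ τ 11 0 = cap ∨ ∃ i : ℕ, i < k ∧ τ 12 0 = i ∧ τ 16 0 = resTail T H x i ∧
    τ 17 0 = resHead T H x i ∧ Crossing T H x m i ∧ τ 11 0 = resCost T H C x π i ∧ τ 11 0 < cap) ∧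
  ∀ i : ℕ, i < t → i < k → Crossing T H x m i → τ 11 0 ≤ resCost T H C x π i

theorem run_compareArc {cap : ℤ} {k t : ℕ} {τ : State} (hk : τ 20 0 = k) (ht : τ 22 0 = t)
    (h : BestArc (τ 2) (τ 3) (τ 4) (τ 5) (τ 6) (τ 7) cap k t τ) :
    BestArc (τ 2) (τ 3) (τ 4) (τ 5) (τ 6) (τ 7) cap k (t + 1) (compareArc.run τ) := by
  obtain ⟨h₁, h₂, h₃⟩ := h
  have keep : ∀ τ' : State, τ' 11 = τ 11 → τ' 12 = τ 12 → τ' 16 = τ 16 → τ' 17 = τ 17 →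
      (t < k → Crossing (τ 2) (τ 3) (τ 5) (τ 7) t →
        τ 11 0 ≤ resCost (τ 2) (τ 3) (τ 4) (τ 5) (τ 6) t) →
      BestArc (τ 2) (τ 3) (τ 4) (τ 5) (τ 6) (τ 7) cap k (t + 1) τ' := by
    intro τ' e₁ e₂ e₃ e₄ hlast
    refine ⟨by rwa [e₁], by rwa [e₁, e₂, e₃, e₄], fun i hi hik hc => ?_⟩
    rw [e₁]
    rcases Nat.lt_succ_iff_lt_or_eq.1 hi with hi | rfl
    · exact h₃ i hi hik hc
    · exact hlast hik hc
  by_cases hkt : t < k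
  swap
  · have : compareArc.run τ = τ := by simp [compareArc, run, Expr.val, hk, ht, hkt]
    rw [this]
    exact keep τ rfl rfl rfl rfl fun h => absurd h hkt
  by_cases hc : Crossing (τ 2) (τ 3) (τ 5) (τ 7) t
  swap
  · apply keep
    -- The first four goals say that the pass leaves the record of the best arc, in arrays `11`,
    -- `12`, `16` and `17`, unchanged.
    iterate 4
      by_cases hx : τ 5 t = 0 <;>
        simp only [Crossing, resTail, resHead, hx, if_true, if_false, not_and, ne_eq] at hc <;>
        by_cases h₄ : τ 7 (τ 2 t) = 0 <;> by_cases h₅ : τ 7 (τ 3 t) = 0 <;>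
        simp [compareArc, run, Expr.val, hk, ht, hkt, hx, h₄, h₅] at hc ⊢
    exact fun _ h => absurd h hc
  by_cases hlt : resCost (τ 2) (τ 3) (τ 4) (τ 5) (τ 6) t < τ 11 0
  swap
  · apply keep
    iterate 4
      obtain ⟨hc₁, hc₂⟩ := hc
      by_cases hx : τ 5 t = 0 <;>
        simp only [resCost, resTail, resHead, hx, if_true, if_false] at hc₁ hc₂ hlt <;>
        simp [compareArc, run, Expr.val, hk, ht, hkt, hx, hc₁, hc₂, hlt]
    exact fun _ _ => not_lt.1 hlt
  · have key : compareArc.run τ 11 0 = resCost (τ 2) (τ 3) (τ 4) (τ 5) (τ 6) t ∧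
        compareArc.run τ 12 0 = t ∧ compareArc.run τ 16 0 = resTail (τ 2) (τ 3) (τ 5) t ∧
        compareArc.run τ 17 0 = resHead (τ 2) (τ 3) (τ 5) t := by
      obtain ⟨hc₁, hc₂⟩ := hc
      by_cases hx : τ 5 t = 0 <;>
        simp only [resCost, resTail, resHead, hx, if_true, if_false] at hc₁ hc₂ hlt ⊢ <;>
        simp [compareArc, run, Expr.val, hk, ht, hkt, hx, hc₁, hc₂, hlt]
    obtain ⟨e₁, e₂, e₃, e₄⟩ := key
    refine ⟨by rw [e₁]; linarith, Or.inr ⟨t, hkt, e₂, e₃, e₄, hc, e₁, by rw [e₁]; linarith⟩, ?_⟩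
    intro i hi hik hci
    rw [e₁]
    rcases Nat.lt_succ_iff_lt_or_eq.1 hi with hi | rfl
    · exact hlt.le.trans (h₃ i hi hik hci)
    · exact le_rfl

/-- The search for a cheapest arc that leaves the set of marked nodes. -/
def findArc : LoopProg :=
  .store 11 (.const 0) (var 10) ;; .store 12 (.const 0) (.const (-1)) ;; .loop 22 compareArc

theorem run_findArc {σ : State} {k M : ℕ} (hM : σ 0 0 = M) (hk : σ 20 0 = k) :
    BestArc (σ 2) (σ 3) (σ 4) (σ 5) (σ 6) (σ 7) (σ 10 0) k M (findArc.run σ) := by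
  simp only [findArc, run]
  refine run_loop (BestArc (σ 2) (σ 3) (σ 4) (σ 5) (σ 6) (σ 7) (σ 10 0) k) (by simpa) ?_ ?_
  · simp [BestArc, Expr.val]
  · intro t ht τ hτ hf h
    have e : ∀ b ∈ ({2, 3, 4, 5, 6, 7, 20} : Finset ℕ), τ b = σ b := by
      intro b hb
      have h22 : b ≠ 22 := by rintro rfl; revert hb; decide
      have hw : b ∉ compareArc.writes :=
        (by decide : ∀ b ∈ ({2, 3, 4, 5, 6, 7, 20} : Finset ℕ), b ∉ compareArc.writes) b hb
      rw [hf b h22 hw]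
      rw [State.write_ne, State.write_ne] <;> rintro rfl <;> revert hb <;> decide
    have := run_compareArc (cap := σ 10 0) (by rw [e 20 (by decide), hk]) hτ
      (by rwa [e 2 (by decide), e 3 (by decide), e 4 (by decide), e 5 (by decide),
        e 6 (by decide), e 7 (by decide)])
    rw [e 2 (by decide), e 3 (by decide), e 4 (by decide), e 5 (by decide),
        e 6 (by decide), e 7 (by decide)] at this
    simpa [BestArc] using this

/-- Array `8` is a table with rows of length `M`, one for each node; different rows do not overlap.
-/
theorem mul_add_inj {M i i' : ℕ} {w w' : ℤ} (hi : i < M) (hi' : i' < M)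
    (h : w * M + i = w' * M + i') : w = w' ∧ i = i' := by
  have hM : (0 : ℤ) < M := by omega
  have h₁ : (w * M + i) / M = w := by
    rw [add_comm, Int.add_mul_ediv_right _ _ hM.ne', Int.ediv_eq_zero_of_lt (by omega) (by omega),
      zero_add]
  have h₂ : (w' * M + i') / M = w' := by
    rw [add_comm, Int.add_mul_ediv_right _ _ hM.ne', Int.ediv_eq_zero_of_lt (by omega) (by omega),
      zero_add]
  have : w = w' := by rw [← h₁, ← h₂, h]
  subst this
  exact ⟨rfl, by omega⟩

/-- Marks the target of the arc that has been found. -/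
def markArc : LoopProg :=
  copyBlock 8 (.mul (var 17) (var 0)) 8 (.mul (var 16) (var 0)) ;;
  .store 8 (.add (.mul (var 17) (var 0)) (var 12)) (.sub (.const 1) (.load 5 (var 12))) ;;
  .store 6 (var 17) (.add (.load 6 (var 17)) (var 9)) ;;
  .store 7 (var 17) (.const 1)

theorem run_markArc {σ : State} {M j : ℕ} {a b : ℤ} (hM : σ 0 0 = M) (ha : σ 16 0 = a)
    (hb : σ 17 0 = b) (hj : σ 12 0 = j) (hjM : j < M) (hab : a ≠ b) :
    markArc.run σ 6 = Function.update (σ 6) b (σ 6 b + σ 9 0) ∧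
    markArc.run σ 7 = Function.update (σ 7) b 1 ∧
    (∀ w, w ≠ b → ∀ i : ℕ, i < M → markArc.run σ 8 (w * M + i) = σ 8 (w * M + i)) ∧
    (∀ i : ℕ, i < M → i ≠ j → markArc.run σ 8 (b * M + i) = σ 8 (a * M + i)) ∧
    markArc.run σ 8 (b * M + j) = 1 - σ 5 j := by
  have frame : ∀ c, c ≠ 22 → c ≠ 8 →
      (copyBlock 8 (.mul (var 17) (var 0)) 8 (.mul (var 16) (var 0))).run σ c = σ c :=
    fun c h h' => run_of_notMem (by simp [copyBlock, writes, h, h']) σ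
  obtain ⟨h₁, h₂⟩ := run_copyBlock (d := 8) (s := 8) (p := .mul (var 17) (var 0))
    (q := .mul (var 16) (var 0)) (by decide) (by decide) (P := b * M) (Q := a * M) hM
    (fun τ h => by simp [Expr.val, h, hb, hM]) (fun τ h => by simp [Expr.val, h, ha, hM])
    (fun _ i hi i' hi' e => hab (mul_add_inj hi hi' e).1)
  simp only [markArc, run, Expr.val]
  generalize (copyBlock 8 (.mul (var 17) (var 0)) 8 (.mul (var 16) (var 0))).run σ = ρ at *
  simp only [ne_eq, Nat.reduceEqDiff, not_false_eq_true, State.write_ne,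
    State.write_same', frame, hb, hj, hM, OfNat.zero_ne_ofNat, true_and]
  refine ⟨fun w hw i hi => ?_, fun i hi hij => ?_, ?_⟩
  · rw [Function.update_of_ne fun e => hw (mul_add_inj hi hjM e).1]
    exact h₂ _ fun i' hi' e => hw (mul_add_inj hi hi' e).1
  · rw [Function.update_of_ne fun e => hij (mul_add_inj hi hjM e).2, h₁ i hi]
  · rw [Function.update_self]

/-- One round of the search for cheapest paths. -/
def searchRound : LoopProg :=
  .ite (.load 7 (.load 2 (var 20))) .skip
    (findArc ;; .store 9 (.const 0) (var 11) ;; .ite (.lt (.const (-1)) (var 12)) markArc .skip)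

/-- `w` is a node of the network with `M` arcs. -/
def IsNode (T H : ℤ → ℤ) (M : ℕ) (w : ℤ) : Prop := ∃ i : ℕ, i < M ∧ (w = T i ∨ w = H i)

/-- The invariant of the rounds of the search. -/
def RoundInv (M : ℕ) (T H C x : ℤ → ℤ) (k : ℕ) (v cap : ℤ) (π₀ : ℤ → ℤ) (r : ℕ) (τ : State) :
    Prop :=
  Search T H C x k v cap π₀ (τ 6) (τ 7) (τ 9 0) (fun w i => τ 8 (w * M + i)) ∧
  (∀ w, τ 7 w ≠ 0 → IsNode T H M w) ∧
  (τ 7 (T k) ≠ 0 ∨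
    (τ 9 0 = cap ∧ ∀ i : ℕ, i < k → Crossing T H x (τ 7) i → cap ≤ resCost T H C x (τ 6) i) ∨
    r ≤ ((Finset.range k).filter fun i : ℕ => τ 7 (resHead T H x i) ≠ 0).card)

/-- Progress is measured by the number of arcs whose residual head is marked. A round that does not
end the search marks the residual head of a crossing arc, which increases this number. -/
theorem run_searchRound {M k r : ℕ} {v cap : ℤ} {π₀ : ℤ → ℤ} {τ : State} (hM : τ 0 0 = M)
    (hk : τ 20 0 = k) (hkM : k < M) (hcap : τ 10 0 = cap)
    (h : RoundInv M (τ 2) (τ 3) (τ 4) (τ 5) k v cap π₀ r τ) :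
    RoundInv M (τ 2) (τ 3) (τ 4) (τ 5) k v cap π₀ (r + 1) (searchRound.run τ) := by
  obtain ⟨hS, hN, h₃⟩ := h
  by_cases hu : τ 7 (τ 2 k) = 0
  swap
  · have : searchRound.run τ = τ := by simp [searchRound, run, Expr.val, hk, hu]
    rw [this]
    exact ⟨hS, hN, Or.inl hu⟩
  have hbest := run_findArc hM hk
  have frame : ∀ b, b ∉ findArc.writes → findArc.run τ b = τ b := fun b hb => run_of_notMem hb τ
  have hrun : searchRound.run τ = (if -1 < findArc.run τ 12 0 then
      markArc.run ((findArc.run τ).write 9 0 (findArc.run τ 11 0)) else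
      (findArc.run τ).write 9 0 (findArc.run τ 11 0)) := by
    simp [searchRound, run, Expr.val, hk, hu]
  rw [hrun]
  generalize findArc.run τ = ρ at *
  obtain ⟨b₁, b₂, b₃⟩ := hbest
  rw [hcap] at b₁ b₂
  have f0 := frame 0 (by decide)
  have f2 := frame 2 (by decide)
  have f3 := frame 3 (by decide)
  have f4 := frame 4 (by decide)
  have f5 := frame 5 (by decide)
  have f6 := frame 6 (by decide)
  have f7 := frame 7 (by decide)
  have f8 := frame 8 (by decide)
  have hle : τ 9 0 ≤ ρ 11 0 := by
    rcases b₂ with ⟨-, b₂⟩ | ⟨i, hi, -, -, -, hc, e, -⟩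
    · rw [b₂]; exact hS.le_cap
    · rw [e]; exact hS.le_resCost hi hc
  have hS' := hS.raise hle b₁ fun i hi hc => b₃ i (by omega) hi hc
  rcases b₂ with ⟨b₄, b₅⟩ | ⟨j, hj, b₄, b₅, b₆, b₇, b₈, b₉⟩
  · rw [if_neg (by omega)]
    refine ⟨by simpa [f6, f7, f8] using hS', by simpa [f7] using hN, Or.inr (Or.inl ⟨?_, ?_⟩)⟩
    · simpa using b₅
    · intro i hi hc
      simp only [ne_eq, Nat.reduceEqDiff, not_false_eq_true, State.write_ne,
        f6, f7] at hc ⊢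
      rw [← b₅]
      exact b₃ i (by omega) hi hc
  · rw [if_pos (by omega)]
    set ρ' := ρ.write 9 0 (ρ 11 0) with hρ'
    have g : ∀ b, b ≠ 9 → ρ' b = ρ b := fun b hb => State.write_ne _ _ _ hb
    have g9 : ρ' 9 0 = ρ 11 0 := by simp [hρ']
    have hne : resTail (τ 2) (τ 3) (τ 5) j ≠ resHead (τ 2) (τ 3) (τ 5) j := fun e =>
      b₇.1 (e ▸ b₇.2)
    obtain ⟨m₁, m₂, m₃, m₄, m₅⟩ := run_markArc (σ := ρ') (j := j)
      (a := resTail (τ 2) (τ 3) (τ 5) j) (b := resHead (τ 2) (τ 3) (τ 5) j)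
      (M := M) (by rw [g 0 (by decide), f0, hM]) (by rw [g 16 (by decide), b₅])
      (by rw [g 17 (by decide), b₆]) (by rw [g 12 (by decide), b₄]) (by omega) hne
    have m₉ : markArc.run ρ' 9 = ρ' 9 := run_of_notMem (by decide) _
    rw [g 6 (by decide), f6, g9] at m₁
    rw [g 7 (by decide), f7] at m₂
    rw [g 5 (by decide), f5] at m₅
    simp only [g 8 (by decide), f8] at m₃ m₄
    have hfresh : τ 7 (resHead (τ 2) (τ 3) (τ 5) j) = 0 := b₇.2
    refine ⟨?_, ?_, ?_⟩
    · rw [m₁, m₂, m₉, g9]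
      refine hS'.mark hj b₇ b₈.symm rfl (fun w hw i hi => m₃ w ?_ i (by omega))
        (fun i hi hij => m₄ i (by omega) hij) m₅
      rintro rfl
      exact hw hfresh
    · intro w hw
      rw [m₂] at hw
      by_cases e : w = resHead (τ 2) (τ 3) (τ 5) j
      · refine ⟨j, by omega, ?_⟩
        rw [e, resHead]
        split_ifs <;> simp
      · rw [Function.update_of_ne e] at hw
        exact hN w hw
    · rcases h₃ with h₃ | h₃ | h₃
      · exact absurd hu h₃
      -- No crossing arc was cheaper than `cap`, but this round has found one.
      · have := h₃.2 j hj b₇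
        omega
      -- Arc `j` witnesses the strict growth: its residual head was unmarked before the round.
      · refine Or.inr (Or.inr (Nat.succ_le_of_lt (h₃.trans_lt (Finset.card_lt_card ?_))))
        rw [m₂, Finset.ssubset_iff_of_subset]
        · refine ⟨j, ?_, ?_⟩
          · simp [hj]
          · simp [hfresh]
        · intro i
          simp only [Finset.mem_filter, Function.update_apply]
          rintro ⟨hi, hi'⟩
          refine ⟨hi, ?_⟩
          split_ifs
          · exact one_ne_zero
          · exact hi'

/-- Removes all marks. -/
def clearMarks : LoopProg :=
  .loop 22 (.store 7 (.load 2 (var 22)) (.const 0) ;; .store 7 (.load 3 (var 22)) (.const 0))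

/-- Only ends of arcs are ever marked, so it suffices to clear the marks along the list of arcs. -/
theorem run_clearMarks {σ : State} {M : ℕ} (hM : σ 0 0 = M)
    (h : ∀ w, σ 7 w ≠ 0 → IsNode (σ 2) (σ 3) M w) (w : ℤ) : clearMarks.run σ 7 w = 0 := by
  have key := run_loop (fun t τ => ∀ w, τ 7 w ≠ 0 → σ 7 w ≠ 0 ∧
      ∀ i : ℕ, i < t → w ≠ σ 2 i ∧ w ≠ σ 3 i) (c := .store 7 (.load 2 (var 22)) (.const 0) ;;
    .store 7 (.load 3 (var 22)) (.const 0)) (a := 22) hM (by simp) (by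
      intro t ht τ hτ hf ih w hw
      have f2 := hf 2 (by decide) (by decide)
      have f3 := hf 3 (by decide) (by decide)
      simp [run, Expr.val, hτ, f2, f3] at hw
      obtain ⟨h₁, h₂⟩ := ih w hw.2.2
      refine ⟨h₁, fun i hi => ?_⟩
      rcases Nat.lt_succ_iff_lt_or_eq.1 hi with hi | rfl
      · exact h₂ i hi
      · exact ⟨hw.2.1, hw.1⟩)
  by_contra hw
  obtain ⟨h₁, h₂⟩ := key w hw
  obtain ⟨i, hi, hi'⟩ := h w h₁
  have := h₂ i hi
  tauto

/-- Raises and marks the node whose index is the value of an expression, unless it is marked. -/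
def raiseNode (e : Expr) : LoopProg :=
  .ite (.load 7 e) .skip (.store 6 e (.add (.load 6 e) (var 9)) ;; .store 7 e (.const 1))

/-- A node can be an end of many arcs; the mark prevents a second raise, and the raised potential is
an invariant. -/
theorem run_raiseNode {τ : State} {e : Expr} {w : ℤ}
    (he : ∀ τ' : State, (∀ b, b ≠ 6 → b ≠ 7 → τ' b = τ b) → e.val τ' = w) :
    raised ((raiseNode e).run τ 6) ((raiseNode e).run τ 7) (τ 9 0) = raised (τ 6) (τ 7) (τ 9 0) ∧
    (raiseNode e).run τ 7 w ≠ 0 ∧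
    (∀ z, τ 7 z ≠ 0 → (raiseNode e).run τ 7 z ≠ 0) ∧
    ∀ z, (raiseNode e).run τ 7 z ≠ 0 → τ 7 z ≠ 0 ∨ z = w := by
  have h₁ : e.val τ = w := he τ fun _ _ _ => rfl
  by_cases hw : τ 7 w = 0
  · have e₂ : (raiseNode e).run τ 7 = Function.update (τ 7) w 1 := by
      have := he (τ.write 6 w (τ 6 w + τ 9 0)) fun b hb _ => State.write_ne _ _ _ hb
      simp [raiseNode, run, Expr.val, h₁, hw, State.write_same', this]
    have e₁ : (raiseNode e).run τ 6 = Function.update (τ 6) w (τ 6 w + τ 9 0) := by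
      simp [raiseNode, run, Expr.val, h₁, hw, State.write_same']
    rw [e₁, e₂]
    refine ⟨raised_update hw, by simp, fun z hz => ?_, fun z hz => ?_⟩
    · by_cases e : z = w
      · simp [e]
      · simpa [e] using hz
    · by_cases e : z = w
      · exact Or.inr e
      · exact Or.inl (by simpa [e] using hz)
  · have : (raiseNode e).run τ = τ := by simp [raiseNode, run, Expr.val, h₁, hw]
    rw [this]
    exact ⟨rfl, hw, fun _ => id, fun _ => Or.inl⟩

/-- Raises the potential of all nodes that are not marked. -/
def raiseNodes : LoopProg :=
  .loop 22 (raiseNode (.load 2 (var 22)) ;; raiseNode (.load 3 (var 22)))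

/-- In the end all nodes are marked, and then the invariant raised potential is the stored
potential. Reduced costs see the potential only at nodes. -/
theorem run_raiseNodes {σ : State} {M : ℕ} (hM : σ 0 0 = M)
    (h : ∀ w, σ 7 w ≠ 0 → IsNode (σ 2) (σ 3) M w) :
    (∀ w, IsNode (σ 2) (σ 3) M w → raiseNodes.run σ 6 w = raised (σ 6) (σ 7) (σ 9 0) w) ∧
    ∀ w, raiseNodes.run σ 7 w ≠ 0 → IsNode (σ 2) (σ 3) M w := by
  have key := run_loop (fun t τ => raised (τ 6) (τ 7) (σ 9 0) = raised (σ 6) (σ 7) (σ 9 0) ∧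
      (∀ i : ℕ, i < t → τ 7 (σ 2 i) ≠ 0 ∧ τ 7 (σ 3 i) ≠ 0) ∧
      ∀ w, τ 7 w ≠ 0 → IsNode (σ 2) (σ 3) M w)
    (c := raiseNode (.load 2 (var 22)) ;; raiseNode (.load 3 (var 22))) (a := 22) hM
    (by simpa using h) (by
      rintro t ht τ hτ hf ⟨i₁, i₂, i₃⟩
      have f2 := hf 2 (by decide) (by decide)
      have f3 := hf 3 (by decide) (by decide)
      have f9 := hf 9 (by decide) (by decide)
      have hfr : ∀ b, b ≠ 6 → b ≠ 7 → (raiseNode (.load 2 (var 22))).run τ b = τ b := fun b h h' =>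
        run_of_notMem (by simp [raiseNode, writes, h, h']) τ
      obtain ⟨p₁, p₂, p₃, p₄⟩ := run_raiseNode (τ := τ) (e := .load 2 (var 22)) (w := σ 2 t)
        (fun τ' h => by simp [Expr.val, h, hτ, f2])
      simp only [run]
      generalize (raiseNode (.load 2 (var 22))).run τ = τ₁ at *
      obtain ⟨q₁, q₂, q₃, q₄⟩ := run_raiseNode (τ := τ₁) (e := .load 3 (var 22)) (w := σ 3 t)
        (fun τ' h => by simp [Expr.val, h, hτ, f3, hfr])
      generalize (raiseNode (.load 3 (var 22))).run τ₁ = τ₂ at *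
      rw [hfr 9 (by decide) (by decide), f9] at q₁
      rw [f9] at p₁
      simp only [ne_eq, Nat.reduceEqDiff, not_false_eq_true, State.write_ne]
      refine ⟨by rw [q₁, p₁, i₁], fun i hi => ?_, fun w hw => ?_⟩
      · rcases Nat.lt_succ_iff_lt_or_eq.1 hi with hi | rfl
        · exact ⟨q₃ _ (p₃ _ (i₂ i hi).1), q₃ _ (p₃ _ (i₂ i hi).2)⟩
        · exact ⟨q₃ _ p₂, q₂⟩
      · rcases q₄ w hw with hw | rfl
        · rcases p₄ w hw with hw | rfl
          · exact i₃ w hw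
          · exact ⟨t, ht, Or.inl rfl⟩
        · exact ⟨t, ht, Or.inr rfl⟩)
  obtain ⟨k₁, k₂, k₃⟩ := key
  refine ⟨fun w ⟨i, hi, hw⟩ => ?_, k₃⟩
  have hk := congrFun k₁ w
  rw [← hk]
  have : raiseNodes.run σ 7 w ≠ 0 := by
    rcases hw with rfl | rfl
    · exact (k₂ i hi).1
    · exact (k₂ i hi).2
  change raiseNodes.run σ 6 w = raised (raiseNodes.run σ 6) (raiseNodes.run σ 7) _ w
  simp [raised, this]

end UnitFlow

/-! ### Insertion of arcs, one after another -/

namespace UnitFlow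

open RAM RAM.LoopProg

/-- Computes the amount by which the new arc `σ 20 0` violates the optimality of the potential. -/
def setBound : LoopProg :=
  .store 10 (.const 0) (.sub (.sub (.load 6 (.load 3 (var 20))) (.load 6 (.load 2 (var 20))))
    (.load 4 (var 20))) ;;
  .ite (.lt (var 10) (.const 0)) (.store 10 (.const 0) (.const 0)) .skip

theorem run_setBound {σ : State} {k : ℕ} (hk : σ 20 0 = k) :
    setBound.run σ 10 0 = max 0 (-reducedCost (σ 2) (σ 3) (σ 4) (σ 6) k) := by
  have e : (Expr.sub (.sub (.load 6 (.load 3 (var 20))) (.load 6 (.load 2 (var 20))))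
      (.load 4 (var 20))).val σ = -reducedCost (σ 2) (σ 3) (σ 4) (σ 6) k := by
    simp only [Expr.val, hk, reducedCost]
    ring
  rw [setBound, run_seq, run_store, e]
  generalize -reducedCost (σ 2) (σ 3) (σ 4) (σ 6) k = z
  have hτ : σ.write 10 ((Expr.const 0).val σ) z 10 0 = z := by simp [Expr.val]
  generalize σ.write 10 ((Expr.const 0).val σ) z = τ at *
  by_cases h : z < 0
  · rw [run_ite_of_ne_zero (by simp [Expr.val, hτ, h])]
    simp [run, Expr.val, max_eq_left h.le]
  · rw [run_ite_of_eq_zero (by simp [Expr.val, hτ, h]), max_eq_right (not_lt.1 h)]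
    exact hτ

/-- Starts the search for a cheapest path that closes a circuit through the new arc `σ 20 0`. -/
def startSearch : LoopProg :=
  setBound ;;
  .store 9 (.const 0) (.const 0) ;;
  clearMarks ;;
  .store 7 (.load 3 (var 20)) (.const 1) ;;
  copyBlock 8 (.mul (.load 3 (var 20)) (var 0)) 5 (.const 0)

/-- The search begins with the head of the new arc as the only marked node; the empty path to it
leaves the flow unchanged, so its row of array `8` is a copy of the flow. -/
theorem run_startSearch {σ : State} {M k : ℕ} (hM : σ 0 0 = M) (hk : σ 20 0 = k) (hkM : k < M)
    (h : Certified (σ 2) (σ 3) (σ 4) k (σ 5) (σ 6)) (hN : ∀ w, σ 7 w ≠ 0 → IsNode (σ 2) (σ 3) M w) :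
    startSearch.run σ 10 0 = max 0 (-reducedCost (σ 2) (σ 3) (σ 4) (σ 6) k) ∧
    RoundInv M (σ 2) (σ 3) (σ 4) (σ 5) k (σ 3 k) (max 0 (-reducedCost (σ 2) (σ 3) (σ 4) (σ 6) k))
      (σ 6) 0 (startSearch.run σ) := by
  have e₂ := run_setBound hk
  have hcap : 0 ≤ max 0 (-reducedCost (σ 2) (σ 3) (σ 4) (σ 6) k) := le_max_left _ _
  generalize max 0 (-reducedCost (σ 2) (σ 3) (σ 4) (σ 6) k) = cap at *
  simp only [startSearch, run]
  have f₂ : ∀ b, b ≠ 10 → setBound.run σ b = σ b := fun b hb =>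
    run_of_notMem (by simp [setBound, writes, hb]) _
  generalize setBound.run σ = σ₂ at *
  obtain ⟨σ₃, hσ₃⟩ : ∃ σ₃, σ₂.write 9 ((Expr.const 0).val σ₂) ((Expr.const 0).val σ₂) = σ₃ := ⟨_, rfl⟩
  rw [hσ₃]
  have e₃ : σ₃ 9 0 = 0 := by simp [← hσ₃, Expr.val]
  have f₃ : ∀ b, b ≠ 10 → b ≠ 9 → σ₃ b = σ b := fun b hb hb' => by
    rw [← hσ₃, State.write_ne _ _ _ hb', f₂ b hb]
  have e₃' : σ₃ 10 0 = cap := by rw [← hσ₃, State.write_ne _ _ _ (by decide), e₂]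
  have e₄ := run_clearMarks (σ := σ₃) (M := M) (by rw [f₃ 0 (by decide) (by decide), hM])
    (by rw [f₃ 2 (by decide) (by decide), f₃ 3 (by decide) (by decide),
      f₃ 7 (by decide) (by decide)]; exact hN)
  have f₄ : ∀ b, b ≠ 22 → b ≠ 7 → clearMarks.run σ₃ b = σ₃ b := fun b hb hb' =>
    run_of_notMem (by simp [clearMarks, writes, hb, hb']) _
  generalize clearMarks.run σ₃ = σ₄ at *
  have hT : (Expr.load 3 (var 20)).val σ₄ = σ 3 k := by
    simp [Expr.val, f₄, f₃, hk]
  rw [hT]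
  set σ₅ := σ₄.write 7 (σ 3 k) _ with hσ₅
  have e₅ : ∀ w, σ₅ 7 w ≠ 0 ↔ w = σ 3 k := by
    intro w
    simp [hσ₅, Expr.val, e₄]
  have f₅ : ∀ b, b ≠ 22 → b ≠ 7 → b ≠ 9 → b ≠ 10 → σ₅ b = σ b := fun b h₁ h₂ h₃ h₄ => by
    rw [hσ₅, State.write_ne _ _ _ h₂, f₄ b h₁ h₂, f₃ b h₄ h₃]
  have e₉ : σ₅ 9 0 = 0 := by simp [hσ₅, f₄, e₃]
  have e₁₀ : σ₅ 10 0 = cap := by simp [hσ₅, f₄, e₃']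
  clear_value σ₅
  obtain ⟨c₁, -⟩ := run_copyBlock (σ := σ₅) (d := 8) (s := 5)
    (p := .mul (.load 3 (var 20)) (var 0)) (q := .const 0) (by decide) (by decide)
    (P := σ 3 k * M) (Q := 0) (M := M) (by simp [f₅, hM])
    (fun τ h => by simp [Expr.val, h, f₅, hk, hM]) (fun τ h => rfl) (fun h => absurd h (by decide))
  have f₆ : ∀ b, b ≠ 22 → b ≠ 8 → (copyBlock 8 (.mul (.load 3 (var 20)) (var 0)) 5
      (.const 0)).run σ₅ b = σ₅ b := fun b hb hb' =>
    run_of_notMem (by simp [copyBlock, writes, hb, hb']) _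
  generalize (copyBlock 8 (.mul (.load 3 (var 20)) (var 0)) 5 (.const 0)).run σ₅ = σ₆ at *
  refine ⟨by simp [f₆, e₁₀], ?_, ?_, Or.inr (Or.inr (Nat.zero_le _))⟩
  · rw [f₆ 9 (by decide) (by decide), e₉, f₆ 6 (by decide) (by decide), f₆ 7 (by decide) (by decide),
      f₅ 6 (by decide) (by decide) (by decide) (by decide)]
    refine h.search hcap e₅ fun i hi => ?_
    rw [c₁ i (by omega), f₅ 5 (by decide) (by decide) (by decide) (by decide), zero_add]
  · intro w hw
    rw [f₆ 7 (by decide) (by decide), e₅] at hw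
    exact ⟨k, hkM, Or.inr hw⟩

/-- Sends flow through the new arc if this reduces the cost. -/
def augment : LoopProg :=
  .ite (.lt (.const 0) (var 10))
    (.ite (.load 7 (.load 2 (var 20)))
      (copyBlock 5 (.const 0) 8 (.mul (.load 2 (var 20)) (var 0)) ;;
        .store 5 (var 20) (.const 1))
      (.store 5 (var 20) (.const 0)))
    (.store 5 (var 20) (.const 0))

theorem run_augment {σ : State} {M k : ℕ} {π₀ : ℤ → ℤ} (hM : σ 0 0 = M) (hk : σ 20 0 = k)
    (hkM : k < M) (hcap : σ 10 0 = max 0 (-reducedCost (σ 2) (σ 3) (σ 4) π₀ k))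
    (hc : ∀ φ, change (σ 2) (σ 3) (σ 5) k φ = 0)
    (h : RoundInv M (σ 2) (σ 3) (σ 4) (σ 5) k (σ 3 k) (σ 10 0) π₀ M σ) :
    Certified (σ 2) (σ 3) (σ 4) (k + 1) (augment.run σ 5) (raised (σ 6) (σ 7) (σ 9 0)) := by
  obtain ⟨hS, -, h₃⟩ := h
  have keep : augment.run σ = σ.write 5 k 0 → (σ 10 0 ≤ 0 ∨ σ 7 (σ 2 k) = 0 ∧ σ 9 0 = σ 10 0) →
      Certified (σ 2) (σ 3) (σ 4) (k + 1) (augment.run σ 5) (raised (σ 6) (σ 7) (σ 9 0)) := by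
    intro e hm
    refine hS.certified_keep hcap hm hc (fun i hi => ?_) ?_
    · rw [e, State.write_same, if_neg (by omega)]
    · rw [e, State.write_same, if_pos rfl]
  by_cases hpos : 0 < σ 10 0
  swap
  · exact keep (by simp [augment, run, Expr.val, hpos, hk]) (Or.inl (not_lt.1 hpos))
  by_cases hu : σ 7 (σ 2 k) = 0
  · refine keep (by simp [augment, run, Expr.val, hpos, hk, hu]) (Or.inr ⟨hu, ?_⟩)
    rcases h₃ with h₃ | h₃ | h₃
    · exact absurd hu h₃
    · exact h₃.1
    -- Only `k` arcs are counted by the progress measure, and `M > k` rounds have been made, so the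
    -- search has ended.
    · have := (h₃.trans (Finset.card_filter_le _ _)).trans_eq (Finset.card_range k)
      omega
  · obtain ⟨c₁, -⟩ := run_copyBlock (σ := σ) (d := 5) (s := 8)
      (p := .const 0) (q := .mul (.load 2 (var 20)) (var 0)) (by decide) (by decide)
      (P := 0) (Q := σ 2 k * M) (M := M) hM (fun τ h => rfl)
      (fun τ h => by simp [Expr.val, h, hk, hM]) (fun h => absurd h (by decide))
    have f : (copyBlock 5 (.const 0) 8 (.mul (.load 2 (var 20)) (var 0))).run σ 20 = σ 20 :=
      run_of_notMem (by decide) _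
    have e : augment.run σ = ((copyBlock 5 (.const 0) 8
        (.mul (.load 2 (var 20)) (var 0))).run σ).write 5 k 1 := by
      simp [augment, run, Expr.val, hpos, hk, hu, f]
    refine hS.certified_augment hcap hpos hu (fun i hi => ?_) ?_
    · rw [e, State.write_same, if_neg (by omega), ← c₁ i (by omega), zero_add]
    · rw [e, State.write_same, if_pos rfl]

/-- Insertion of the arc `σ 20 0`. -/
def insertArc : LoopProg := startSearch ;; .loop 21 searchRound ;; augment ;; raiseNodes

/-- The flow and the potential are optimal for the first `k` arcs. -/
def Solved (M k : ℕ) (σ : State) : Prop :=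
  Certified (σ 2) (σ 3) (σ 4) k (σ 5) (σ 6) ∧ ∀ w, σ 7 w ≠ 0 → IsNode (σ 2) (σ 3) M w

theorem run_insertArc {σ : State} {M k : ℕ} (hM : σ 0 0 = M) (hk : σ 20 0 = k) (hkM : k < M)
    (h : Solved M k σ) : Solved M (k + 1) (insertArc.run σ) := by
  obtain ⟨hC, hN⟩ := h
  obtain ⟨hcap, h₀⟩ := run_startSearch hM hk hkM hC hN
  simp only [insertArc, run]
  have f₁ : ∀ b ∈ ({0, 2, 3, 4, 5, 20} : Finset ℕ), startSearch.run σ b = σ b := fun b hb =>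
    run_of_notMem ((by decide : ∀ b ∈ ({0, 2, 3, 4, 5, 20} : Finset ℕ), b ∉ startSearch.writes)
      b hb) _
  generalize startSearch.run σ = σ₁ at *
  have hM₁ : σ₁ 0 0 = M := by rw [f₁ 0 (by decide), hM]
  rw [← hcap] at h₀
  have h₁ := run_loop (a := 21) (c := searchRound)
    (RoundInv M (σ 2) (σ 3) (σ 4) (σ 5) k (σ 3 k) (σ₁ 10 0) (σ 6)) hM₁
    (by simpa [RoundInv] using h₀) (by
      intro t ht τ hτ hf ih
      have g : ∀ b ∈ ({0, 2, 3, 4, 5, 20} : Finset ℕ), τ b = σ b := fun b hb => by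
        have := (by decide : ∀ b ∈ ({0, 2, 3, 4, 5, 20} : Finset ℕ),
          b ≠ 21 ∧ b ∉ searchRound.writes) b hb
        rw [hf b this.1 this.2, f₁ b hb]
      have := run_searchRound (v := σ 3 k) (cap := σ₁ 10 0) (π₀ := σ 6) (r := t) (M := M) (τ := τ)
        (k := k) (by rw [g 0 (by decide), hM]) (by rw [g 20 (by decide), hk]) hkM
        (by rw [hf 10 (by decide) (by decide)])
        (by rwa [g 2 (by decide), g 3 (by decide), g 4 (by decide), g 5 (by decide)])
      rw [g 2 (by decide), g 3 (by decide), g 4 (by decide), g 5 (by decide)] at this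
      simpa [RoundInv] using this)
  change RoundInv _ _ _ _ _ _ _ _ _ _ ((loop 21 searchRound).run σ₁) at h₁
  change Solved _ _ (raiseNodes.run (augment.run ((loop 21 searchRound).run σ₁)))
  have f₂ : ∀ b ∈ ({0, 2, 3, 4, 5, 20} : Finset ℕ), (loop 21 searchRound).run σ₁ b = σ b :=
    fun b hb => by
      rw [run_of_notMem ((by decide : ∀ b ∈ ({0, 2, 3, 4, 5, 20} : Finset ℕ),
        b ∉ (loop 21 searchRound).writes) b hb), f₁ b hb]
  have g₂ : (loop 21 searchRound).run σ₁ 10 = σ₁ 10 := run_of_notMem (by decide) _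
  generalize (loop 21 searchRound).run σ₁ = σ₂ at *
  have hN₂ := h₁.2.1
  rw [← f₂ 2 (by decide), ← f₂ 3 (by decide), ← f₂ 4 (by decide), ← f₂ 5 (by decide), ← g₂] at h₁
  have h₂ := run_augment (by rw [f₂ 0 (by decide), hM]) (by rw [f₂ 20 (by decide), hk]) hkM
    (by rw [g₂, hcap, f₂ 2 (by decide), f₂ 3 (by decide), f₂ 4 (by decide)])
    (by rw [f₂ 2 (by decide), f₂ 3 (by decide), f₂ 5 (by decide)]; exact hC.2) h₁
  have f₃ : ∀ b ∈ ({0, 2, 3, 4, 6, 7, 9} : Finset ℕ), augment.run σ₂ b = σ₂ b := fun b hb =>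
    run_of_notMem ((by decide : ∀ b ∈ ({0, 2, 3, 4, 6, 7, 9} : Finset ℕ), b ∉ augment.writes)
      b hb) _
  generalize augment.run σ₂ = σ₃ at *
  have e2 : σ₃ 2 = σ 2 := by rw [f₃ 2 (by decide), f₂ 2 (by decide)]
  have e3 : σ₃ 3 = σ 3 := by rw [f₃ 3 (by decide), f₂ 3 (by decide)]
  have e4 : σ₃ 4 = σ 4 := by rw [f₃ 4 (by decide), f₂ 4 (by decide)]
  obtain ⟨r₁, r₂⟩ := run_raiseNodes (σ := σ₃) (M := M)
    (by rw [f₃ 0 (by decide), f₂ 0 (by decide), hM])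
    (by rw [e2, e3, f₃ 7 (by decide)]; exact hN₂)
  have f₄ : ∀ b ∈ ({2, 3, 4, 5} : Finset ℕ), raiseNodes.run σ₃ b = σ₃ b := fun b hb =>
    run_of_notMem ((by decide : ∀ b ∈ ({2, 3, 4, 5} : Finset ℕ), b ∉ raiseNodes.writes) b hb) _
  rw [← f₃ 6 (by decide), ← f₃ 7 (by decide), ← f₃ 9 (by decide), ← f₃ 2 (by decide),
    ← f₃ 3 (by decide), ← f₃ 4 (by decide)] at h₂
  unfold Solved
  rw [f₄ 2 (by decide), f₄ 3 (by decide), f₄ 4 (by decide), f₄ 5 (by decide)]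
  refine ⟨⟨fun i hi => ?_, h₂.2⟩, r₂⟩
  have := h₂.1 i hi
  unfold reducedCost at this ⊢
  rwa [r₁ _ ⟨i, by omega, Or.inl rfl⟩, r₁ _ ⟨i, by omega, Or.inr rfl⟩]

/-- Computes a circulation of minimal cost. -/
def solve : LoopProg := .loop 20 insertArc

theorem run_solve {σ : State} {M : ℕ} (hM : σ 0 0 = M) (h : ∀ w, σ 7 w = 0) :
    Certified (σ 2) (σ 3) (σ 4) M (solve.run σ 5) (solve.run σ 6) := by
  have f : ∀ b ∈ ({2, 3, 4} : Finset ℕ), solve.run σ b = σ b := fun b hb =>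
    run_of_notMem ((by decide : ∀ b ∈ ({2, 3, 4} : Finset ℕ), b ∉ solve.writes) b hb) _
  have := run_loop (a := 20) (c := insertArc) (Solved M) hM
    ⟨⟨fun i hi => absurd hi (Nat.not_lt_zero i), fun φ => by simp [change]⟩, by simp [h]⟩ (by
      intro t ht τ hτ hf ih
      have h0 : τ 0 = σ 0 := hf 0 (by decide) (by decide)
      have := run_insertArc (M := M) (by rw [h0, hM]) hτ ht ih
      simpa [Solved] using this)
  have := this.1
  rwa [← f 2 (by decide), ← f 3 (by decide), ← f 4 (by decide)]

end UnitFlow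

/-! ### Soft repairing as a circulation problem -/

namespace SoftRepair

open UnitFlow

/-- The number of earlier indices in `X` with the same value as `j`. -/
def rank (A : ℕ → ℕ) (X : Finset ℕ) (j : ℕ) : ℕ := (X.filter fun i => i < j ∧ A i = A j).card

/-- The number of pairs of different indices in `X` with the same value. -/
def conflicts (A : ℕ → ℕ) (X : Finset ℕ) : ℕ := ∑ j ∈ X, rank A X j

/-- The number of indices in `X` with value `a`. -/
def count (A : ℕ → ℕ) (X : Finset ℕ) (a : ℕ) : ℕ := (X.filter fun i => A i = a).card

/-- Each `r` below the size of `J` is the rank of exactly one element: a new maximum receives the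
next rank and leaves the others alone. -/
theorem sum_card_lt {R : Type*} [AddCommMonoid R] (J : Finset ℕ) (h : ℕ → R) :
    ∑ j ∈ J, h (J.filter (· < j)).card = ∑ r ∈ Finset.range J.card, h r := by
  induction J using Finset.induction_on_max with
  | empty => simp
  | insert a s hs ih =>
    have ha : a ∉ s := fun h => lt_irrefl _ (hs a h)
    rw [Finset.sum_insert ha, Finset.card_insert_of_notMem ha, Finset.sum_range_succ, add_comm]
    congr 1
    · rw [← ih]
      refine Finset.sum_congr rfl fun j hj => ?_
      rw [Finset.filter_insert, if_neg (not_lt.2 (hs j hj).le)]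
    · rw [Finset.filter_insert, if_neg (lt_irrefl a), Finset.filter_true_of_mem hs]

theorem sum_rank {R : Type*} [AddCommMonoid R] (A : ℕ → ℕ) {X U : Finset ℕ}
    (hU : ∀ j ∈ X, A j ∈ U) (h : ℕ → ℕ → R) :
    ∑ j ∈ X, h (A j) (rank A X j) = ∑ a ∈ U, ∑ r ∈ Finset.range (count A X a), h a r := by
  rw [← Finset.sum_fiberwise_of_maps_to hU]
  refine Finset.sum_congr rfl fun a _ => ?_
  rw [count, ← sum_card_lt]
  refine Finset.sum_congr rfl fun j hj => ?_
  rw [Finset.mem_filter] at hj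
  rw [hj.2, rank, Finset.filter_filter]
  congr 2
  ext i
  simp only [Finset.mem_filter, hj.2, and_comm]

theorem conflicts_eq (A : ℕ → ℕ) {X U : Finset ℕ} (hU : ∀ j ∈ X, A j ∈ U) :
    conflicts A X = ∑ a ∈ U, ∑ r ∈ Finset.range (count A X a), r :=
  sum_rank A hU fun _ r => r

/-- Ranks can only grow with the ambient set. This is why a flow with an arbitrary choice of ground
arcs pays at least for the conflicts. -/
theorem conflicts_le_sum_rank (A : ℕ → ℕ) {X Y : Finset ℕ} (h : X ⊆ Y) :
    conflicts A X ≤ ∑ j ∈ X, rank A Y j :=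
  Finset.sum_le_sum fun _ _ => Finset.card_le_card (Finset.filter_subset_filter _ h)

theorem count_le_count (A : ℕ → ℕ) {X Y : Finset ℕ} (h : X ⊆ Y) (a : ℕ) :
    count A X a ≤ count A Y a :=
  Finset.card_le_card (Finset.filter_subset_filter _ h)

theorem sum_eq_sum_count (A : ℕ → ℕ) {X U : Finset ℕ} (hU : ∀ j ∈ X, A j ∈ U) (g : ℕ → ℤ) :
    ∑ j ∈ X, g (A j) = ∑ a ∈ U, count A X a * g a := by
  rw [← Finset.sum_fiberwise_of_maps_to hU]
  refine Finset.sum_congr rfl fun a _ => ?_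
  rw [Finset.sum_congr rfl (g := fun _ => g a) fun j hj => by rw [(Finset.mem_filter.1 hj).2]]
  simp [count]

/-- The flow from the ground node to the nodes of the values of `A`, if the indices in `X` are
kept. -/
def groundFlow (A : ℕ → ℕ) (Y X : Finset ℕ) (j : ℕ) : ℤ :=
  if rank A Y j < count A X (A j) then 1 else 0

/-- For each value `a`, `groundFlow` selects the `count A X a` ground arcs of smallest rank, whose
ranks are an initial segment. -/
theorem sum_groundFlow_aux (A : ℕ → ℕ) {X Y : Finset ℕ} (h : X ⊆ Y) (f : ℕ → ℕ → ℤ) :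
    ∑ j ∈ Y, groundFlow A Y X j * f (A j) (rank A Y j) =
      ∑ a ∈ Y.image A, ∑ r ∈ Finset.range (count A X a), f a r := by
  have := sum_rank A (X := Y) (U := Y.image A) (fun j hj => Finset.mem_image_of_mem A hj)
    fun a r => (if r < count A X a then 1 else 0) * f a r
  refine Eq.trans this (Finset.sum_congr rfl fun a _ => ?_)
  have hsub : Finset.range (count A X a) ⊆ Finset.range (count A Y a) :=
    Finset.range_subset_range.2 (count_le_count A h a)
  rw [← Finset.sum_subset hsub]
  · refine Finset.sum_congr rfl fun r hr => ?_
    rw [if_pos (Finset.mem_range.1 hr), one_mul]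
  · intro r _ hr
    rw [if_neg (by simpa using hr), zero_mul]

theorem sum_groundFlow (A : ℕ → ℕ) {X Y : Finset ℕ} (h : X ⊆ Y) (g : ℕ → ℤ) :
    ∑ j ∈ Y, groundFlow A Y X j * g (A j) = ∑ j ∈ X, g (A j) := by
  rw [sum_groundFlow_aux A h fun a _ => g a, sum_eq_sum_count A (U := Y.image A)
    fun j hj => Finset.mem_image_of_mem A (h hj)]
  simp

theorem sum_groundFlow_rank (A : ℕ → ℕ) {X Y : Finset ℕ} (h : X ⊆ Y) :
    ∑ j ∈ Y, groundFlow A Y X j * (rank A Y j : ℤ) = conflicts A X := by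
  rw [sum_groundFlow_aux A h fun _ r => (r : ℤ),
    conflicts_eq A (U := Y.image A) fun j hj => Finset.mem_image_of_mem A (h hj)]
  push_cast
  rfl

/-! ### The network and its circulations -/

/-- The network for soft repairing: node `0` is the ground, the constants `a` of the first and `b` of
the second attribute are the nodes `2 * a + 1` and `2 * b + 2`. -/
structure IsNetwork (N : ℕ) (A B : ℕ → ℕ) (W : ℕ → ℤ) (W₁ W₂ : ℤ) (T H C : ℤ → ℤ) : Prop where
  tail₀ : ∀ j < N, T (3 * j) = 0
  head₀ : ∀ j < N, H (3 * j) = 2 * A j + 1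
  cost₀ : ∀ j < N, C (3 * j) = rank A (Finset.range N) j * W₁
  tail₁ : ∀ j < N, T (3 * j + 1) = 2 * A j + 1
  head₁ : ∀ j < N, H (3 * j + 1) = 2 * B j + 2
  cost₁ : ∀ j < N, C (3 * j + 1) = -W j
  tail₂ : ∀ j < N, T (3 * j + 2) = 2 * B j + 2
  head₂ : ∀ j < N, H (3 * j + 2) = 0
  cost₂ : ∀ j < N, C (3 * j + 2) = rank B (Finset.range N) j * W₂
  default : ∀ i : ℕ, 3 * N ≤ i → T i = 0 ∧ H i = 0 ∧ C i = 0

theorem sum_range_three_mul {g : ℤ → ℤ} {N M : ℕ} (hM : 3 * N ≤ M)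
    (hg : ∀ i : ℕ, 3 * N ≤ i → g i = 0) :
    ∑ i ∈ Finset.range M, g (i : ℕ) =
      ∑ j ∈ Finset.range N, (g (3 * j) + g (3 * j + 1) + g (3 * j + 2)) := by
  rw [← Finset.sum_subset (Finset.range_subset_range.2 hM) fun i _ hi => hg i (by simpa using hi)]
  clear hM hg
  induction N with
  | zero => simp
  | succ N ih =>
    rw [show 3 * (N + 1) = 3 * N + 1 + 1 + 1 by ring, Finset.sum_range_succ, Finset.sum_range_succ,
      Finset.sum_range_succ, ih, Finset.sum_range_succ _ N]
    push_cast
    ring_nf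

variable {N M : ℕ} {A B : ℕ → ℕ} {W : ℕ → ℤ} {W₁ W₂ : ℤ} {T H C : ℤ → ℤ}

/-- The arcs from `3 * N` on are loops of cost zero at the ground, which fill the network up to the
`M` arcs that the solver expects. -/
theorem IsNetwork.change_eq (h : IsNetwork N A B W W₁ W₂ T H C) (hM : 3 * N ≤ M) (x φ : ℤ → ℤ) :
    change T H x M φ = ∑ j ∈ Finset.range N, (x (3 * j) * (φ (2 * A j + 1) - φ 0) +
      x (3 * j + 1) * (φ (2 * B j + 2) - φ (2 * A j + 1)) +
      x (3 * j + 2) * (φ 0 - φ (2 * B j + 2))) := by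
  unfold change
  rw [sum_range_three_mul (g := fun i => x i * (φ (H i) - φ (T i))) hM]
  · refine Finset.sum_congr rfl fun j hj => ?_
    rw [Finset.mem_range] at hj
    simp only [h.tail₀ j hj, h.tail₁ j hj, h.tail₂ j hj, h.head₀ j hj, h.head₁ j hj, h.head₂ j hj]
  · intro i hi
    simp only [h.default i hi, sub_self, mul_zero]

theorem IsNetwork.cost_eq (h : IsNetwork N A B W W₁ W₂ T H C) (hM : 3 * N ≤ M) (x : ℤ → ℤ) :
    ∑ i ∈ Finset.range M, C i * x i = ∑ j ∈ Finset.range N,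
      (x (3 * j) * rank A (Finset.range N) j * W₁ - x (3 * j + 1) * W j +
        x (3 * j + 2) * rank B (Finset.range N) j * W₂) := by
  rw [sum_range_three_mul (g := fun i => C i * x i) hM]
  · refine Finset.sum_congr rfl fun j hj => ?_
    rw [Finset.mem_range] at hj
    simp only [h.cost₀ j hj, h.cost₁ j hj, h.cost₂ j hj]
    ring
  · intro i hi
    simp only [h.default i hi, zero_mul]

theorem exists_interleave (a b c : ℕ → ℤ) : ∃ x : ℤ → ℤ, (∀ j : ℕ, x (3 * j) = a j) ∧
    (∀ j : ℕ, x (3 * j + 1) = b j) ∧ ∀ j : ℕ, x (3 * j + 2) = c j := by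
  refine ⟨fun i => if i % 3 = 0 then a (i / 3).toNat else if i % 3 = 1 then b (i / 3).toNat else
    c (i / 3).toNat, fun j => ?_, fun j => ?_, fun j => ?_⟩
  · have h₁ : (3 * j : ℤ) % 3 = 0 := by omega
    have h₂ : ((3 * j : ℤ) / 3).toNat = j := by omega
    simp only [h₁, h₂, if_true]
  · have h₁ : (3 * j + 1 : ℤ) % 3 = 1 := by omega
    have h₂ : ((3 * j + 1 : ℤ) / 3).toNat = j := by omega
    simp only [h₁, h₂, if_true, one_ne_zero, if_false]
  · have h₁ : (3 * j + 2 : ℤ) % 3 = 2 := by omega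
    have h₂ : ((3 * j + 2 : ℤ) / 3).toNat = j := by omega
    simp [h₁, h₂]

/-- The cost of keeping exactly the facts with indices in `X`. -/
def keepCost (N : ℕ) (A B : ℕ → ℕ) (W : ℕ → ℤ) (W₁ W₂ : ℤ) (X : Finset ℕ) : ℤ :=
  ∑ j ∈ Finset.range N \ X, W j + (W₁ * conflicts A X + W₂ * conflicts B X)

theorem keepCost_eq {X : Finset ℕ} (hX : X ⊆ Finset.range N) :
    keepCost N A B W W₁ W₂ X = ∑ j ∈ Finset.range N, W j +
      (W₁ * conflicts A X - ∑ j ∈ X, W j + W₂ * conflicts B X) := by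
  rw [keepCost, ← Finset.sum_sdiff hX]
  ring

theorem sum_indicator {Y : Finset ℕ} (y : ℕ → ℤ) (hy : ∀ j ∈ Y, y j = 0 ∨ y j = 1) (g : ℕ → ℤ) :
    ∑ j ∈ Y, y j * g j = ∑ j ∈ Y.filter fun j => y j = 1, g j := by
  rw [Finset.sum_filter]
  refine Finset.sum_congr rfl fun j hj => ?_
  rcases hy j hj with h | h <;> simp [h]

/-- By conservation, the set `S` of used ground arcs has as many members of each value as `X`, hence
as many conflicts, and the ranks in `Y` that are paid dominate the ranks in `S`. -/
theorem mul_conflicts_le {X Y : Finset ℕ} (hXY : X ⊆ Y) {y : ℕ → ℤ} (hy : ∀ j ∈ Y, y j = 0 ∨ y j = 1)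
    (h : ∀ a, ∑ j ∈ Y, y j * (if A j = a then 1 else 0) = ∑ j ∈ X, if A j = a then 1 else 0)
    (hW : 0 ≤ W₁) : W₁ * conflicts A X ≤ ∑ j ∈ Y, y j * rank A Y j * W₁ := by
  set S := Y.filter fun j => y j = 1 with hS
  have hSY : S ⊆ Y := Finset.filter_subset _ _
  have hcount : ∀ a, count A S a = count A X a := by
    intro a
    have := h a
    rw [sum_indicator y hy, ← Finset.sum_filter, ← Finset.sum_filter] at this
    simpa [count] using this
  have h₁ : conflicts A S = conflicts A X := by
    rw [conflicts_eq A (U := Y.image A) fun j hj => Finset.mem_image_of_mem A (hSY hj),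
      conflicts_eq A (U := Y.image A) fun j hj => Finset.mem_image_of_mem A (hXY hj)]
    simp only [hcount]
  have h₂ := conflicts_le_sum_rank A hSY
  rw [← Finset.sum_mul, sum_indicator y hy, mul_comm, ← h₁]
  refine mul_le_mul_of_nonneg_right ?_ hW
  exact_mod_cast h₂

/-- The indices of the facts that are kept by a flow. -/
def kept (N : ℕ) (x : ℤ → ℤ) : Finset ℕ := (Finset.range N).filter fun j : ℕ => x (3 * j + 1) = 1

/-- The comparison passes through circulations: the kept set costs at most as much as the certified
circulation, which costs at most as much as the one built from `X`. The latter has exactly the cost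
of `X`, up to the constant total weight. -/
theorem IsNetwork.keepCost_le (h : IsNetwork N A B W W₁ W₂ T H C) (hM : 3 * N ≤ M) (hW₁ : 0 ≤ W₁)
    (hW₂ : 0 ≤ W₂) {x π : ℤ → ℤ} (hx : Certified T H C M x π) {X : Finset ℕ}
    (hX : X ⊆ Finset.range N) :
    keepCost N A B W W₁ W₂ (kept N x) ≤ keepCost N A B W W₁ W₂ X := by
  have hkept : kept N x ⊆ Finset.range N := Finset.filter_subset _ _
  rw [keepCost_eq hkept, keepCost_eq hX]
  refine add_le_add_right ?_ _
  have h01 : ∀ i : ℕ, i < M → x i = 0 ∨ x i = 1 := fun i hi => (hx.1 i hi).eq_zero_or_one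
  have x₀ : ∀ j ∈ Finset.range N, x (3 * j) = 0 ∨ x (3 * j) = 1 := fun j hj => by
    rw [Finset.mem_range] at hj
    exact_mod_cast h01 (3 * j) (by omega)
  have x₁ : ∀ j ∈ Finset.range N, x (3 * j + 1) = 0 ∨ x (3 * j + 1) = 1 := fun j hj => by
    rw [Finset.mem_range] at hj
    exact_mod_cast h01 (3 * j + 1) (by omega)
  have x₂ : ∀ j ∈ Finset.range N, x (3 * j + 2) = 0 ∨ x (3 * j + 2) = 1 := fun j hj => by
    rw [Finset.mem_range] at hj
    exact_mod_cast h01 (3 * j + 2) (by omega)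
  -- the cost of the circulation bounds the cost of the facts that it keeps
  have lower : W₁ * conflicts A (kept N x) - ∑ j ∈ kept N x, W j + W₂ * conflicts B (kept N x) ≤
      ∑ i ∈ Finset.range M, C i * x i := by
    rw [h.cost_eq hM, Finset.sum_add_distrib, Finset.sum_sub_distrib,
      sum_indicator (fun j : ℕ => x (3 * j + 1)) x₁]
    have hA := mul_conflicts_le (A := A) hkept (y := fun j : ℕ => x (3 * j)) x₀ (fun a => by
      -- Testing the circulation with the indicator of one node yields conservation of flow there.
      have := hx.2 fun w => if w = 2 * a + 1 then 1 else 0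
      rw [h.change_eq hM] at this
      rw [kept, ← sum_indicator (fun j : ℕ => x (3 * j + 1)) x₁, ← sub_eq_zero,
        ← Finset.sum_sub_distrib]
      refine Eq.trans (Finset.sum_congr rfl fun j _ => ?_) this
      rw [if_neg (show ¬ (0 : ℤ) = 2 * a + 1 by omega),
        if_neg (show ¬ (2 * B j + 2 : ℤ) = 2 * a + 1 by omega)]
      by_cases e : A j = a
      · simp [e]; ring
      · have : ¬ (2 * A j + 1 : ℤ) = 2 * a + 1 := by omega
        simp [e]) hW₁
    have hB := mul_conflicts_le (A := B) hkept (y := fun j : ℕ => x (3 * j + 2)) x₂ (fun b => by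
      -- The sign turns around because the ground arcs of the second attribute leave this node.
      have := hx.2 fun w => if w = 2 * b + 2 then -1 else 0
      rw [h.change_eq hM] at this
      rw [kept, ← sum_indicator (fun j : ℕ => x (3 * j + 1)) x₁, ← sub_eq_zero,
        ← Finset.sum_sub_distrib]
      refine Eq.trans (Finset.sum_congr rfl fun j _ => ?_) this
      rw [if_neg (show ¬ (0 : ℤ) = 2 * b + 2 by omega),
        if_neg (show ¬ (2 * A j + 1 : ℤ) = 2 * b + 2 by omega)]
      by_cases e : B j = b
      · simp [e]; ring
      · have : ¬ (2 * B j + 2 : ℤ) = 2 * b + 2 := by omega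
        simp [e]) hW₂
    exact add_le_add (sub_le_sub_right hA _) hB
  -- a circulation that keeps the facts in `X`
  obtain ⟨x', e₀, e₁, e₂⟩ := exists_interleave (groundFlow A (Finset.range N) X)
    (fun j => if j ∈ X then 1 else 0) (groundFlow B (Finset.range N) X)
  have sumX : ∀ g : ℕ → ℤ, ∑ j ∈ Finset.range N, (if j ∈ X then 1 else 0) * g j = ∑ j ∈ X, g j := by
    intro g
    simp only [ite_mul, one_mul, zero_mul]
    rw [← Finset.sum_filter, Finset.filter_mem_eq_inter, Finset.inter_eq_right.2 hX]
  have upper : ∑ i ∈ Finset.range M, C i * x' i =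
      W₁ * conflicts A X - ∑ j ∈ X, W j + W₂ * conflicts B X := by
    rw [h.cost_eq hM, Finset.sum_add_distrib, Finset.sum_sub_distrib]
    simp only [e₀, e₁, e₂]
    rw [← Finset.sum_mul, ← Finset.sum_mul, sum_groundFlow_rank A hX, sum_groundFlow_rank B hX, sumX]
    ring
  refine lower.trans ((hx.cost_le (x' := x') ?_ ?_).trans_eq upper)
  · intro i hi
    have h01 : ∀ j, (∀ Y : Finset ℕ, ∀ A', groundFlow A' Y X j = 0 ∨ groundFlow A' Y X j = 1) ∧
        ((if j ∈ X then (1 : ℤ) else 0) = 0 ∨ (if j ∈ X then (1 : ℤ) else 0) = 1) := by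
      refine fun j => ⟨fun Y A' => ?_, ?_⟩
      · unfold groundFlow; split_ifs <;> simp
      · split_ifs <;> simp
    obtain ⟨j, rfl | rfl | rfl⟩ : ∃ j, i = 3 * j ∨ i = 3 * j + 1 ∨ i = 3 * j + 2 :=
      ⟨i / 3, by omega⟩
    · push_cast
      rw [e₀]
      exact (h01 j).1 _ _
    · push_cast
      rw [e₁]
      exact (h01 j).2
    · push_cast
      rw [e₂]
      exact (h01 j).1 _ _
  · intro φ
    rw [h.change_eq hM, Finset.sum_add_distrib, Finset.sum_add_distrib]
    simp only [e₀, e₁, e₂]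
    rw [sum_groundFlow A hX fun a => φ (2 * a + 1) - φ 0,
      sum_groundFlow B hX fun b => φ 0 - φ (2 * b + 2), sumX, ← Finset.sum_add_distrib,
      ← Finset.sum_add_distrib]
    exact Finset.sum_eq_zero fun j _ => by ring

/-! ### Violations and conflicts -/

/-- Each unordered pair is counted at its larger index. -/
theorem card_filter_powersetCard_two {α : Type*} [DecidableEq α] {f : ℕ → α} {X : Finset ℕ}
    (hf : Set.InjOn f X) (P : Finset α → Prop) [DecidablePred P] :
    (((X.image f).powersetCard 2).filter P).card =
      ∑ j ∈ X, (X.filter fun i => i < j ∧ P {f i, f j}).card := by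
  rw [← Finset.card_sigma]
  symm
  refine Finset.card_bij (fun p _ => {f p.2, f p.1}) ?_ ?_ ?_
  · rintro ⟨j, i⟩ h
    simp only [Finset.mem_sigma, Finset.mem_filter, Finset.mem_powersetCard] at h ⊢
    obtain ⟨hj, hi, hij, hP⟩ := h
    refine ⟨⟨?_, Finset.card_pair fun e => hij.ne (hf hi hj e)⟩, hP⟩
    simp only [Finset.insert_subset_iff, Finset.singleton_subset_iff]
    exact ⟨Finset.mem_image_of_mem f hi, Finset.mem_image_of_mem f hj⟩
  · rintro ⟨j, i⟩ h ⟨j', i'⟩ h' e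
    simp only [Finset.mem_sigma, Finset.mem_filter] at h h' e
    obtain ⟨hj, hi, hij, -⟩ := h
    obtain ⟨hj', hi', hij', -⟩ := h'
    have hi'' : f i = f i' ∨ f i = f j' := by
      have : f i ∈ ({f i', f j'} : Finset α) := e ▸ Finset.mem_insert_self _ _
      simpa using this
    have hj'' : f j = f i' ∨ f j = f j' := by
      have : f j ∈ ({f i', f j'} : Finset α) := e ▸ by simp
      simpa using this
    have a₁ : i = i' ∨ i = j' := hi''.imp (fun e => hf hi hi' e) fun e => hf hi hj' e
    have a₂ : j = i' ∨ j = j' := hj''.imp (fun e => hf hj hi' e) fun e => hf hj hj' e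
    -- The order of the indices excludes the crossed identification of the two pairs.
    obtain ⟨rfl, rfl⟩ : i = i' ∧ j = j' := by omega
    rfl
  · intro p hp
    simp only [Finset.mem_filter, Finset.mem_powersetCard] at hp
    obtain ⟨⟨hsub, hcard⟩, hP⟩ := hp
    obtain ⟨u, v, huv, rfl⟩ := Finset.card_eq_two.1 hcard
    simp only [Finset.insert_subset_iff, Finset.singleton_subset_iff, Finset.mem_image] at hsub
    obtain ⟨⟨i, hi, rfl⟩, ⟨j, hj, rfl⟩⟩ := hsub
    rcases lt_trichotomy i j with hij | rfl | hij
    · exact ⟨⟨j, i⟩, by simp [hi, hj, hij, hP], rfl⟩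
    · exact absurd rfl huv
    · exact ⟨⟨i, j⟩, by simp [hi, hj, hij, Finset.pair_comm (f j), hP], Finset.pair_comm _ _⟩

/-- With only two attributes, distinct facts that agree on `u` must disagree on `v`, so the
condition on the right-hand side is automatic. -/
theorem card_vio {f : ℕ → Fact 2} {X : Finset ℕ} (hf : Set.InjOn f X) {u v : Fin 2} (huv : u ≠ v) :
    (vio (X.image f) ⟨{u}, {v}⟩).card = conflicts (fun j => f j u) X := by
  classical
  have e : vio (X.image f) ⟨{u}, {v}⟩ = ((X.image f).powersetCard 2).filter fun p =>
      ∃ f ∈ p, ∃ g ∈ p, AgreeOn f g {u} ∧ ¬ AgreeOn f g {v} := by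
    unfold vio
    congr!
  rw [e, card_filter_powersetCard_two hf]
  refine Finset.sum_congr rfl fun j hj => congrArg Finset.card (Finset.filter_congr fun i hi => ?_)
  refine and_congr_right fun hij => ?_
  have hne : f i ≠ f j := fun e => hij.ne (hf hi hj e)
  have hcover : ∀ g g' : Fact 2, g u = g' u → g v = g' v → g = g' := by
    intro g g' h₁ h₂
    funext w
    have : w = u ∨ w = v := by omega
    rcases this with rfl | rfl
    · exact h₁
    · exact h₂
  simp only [AgreeOn, Finset.mem_singleton, forall_eq, Finset.mem_insert, exists_eq_or_imp,
    exists_eq_left, not_true_eq_false, and_false, false_or, or_false]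
  constructor
  · rintro (h | h)
    · exact h.1
    · exact h.1.symm
  · exact fun h => Or.inl ⟨h, fun h' => hne (hcover _ _ h h')⟩

end SoftRepair

/-! ### A program for soft repairing

The arrays `0` to `17` are used as in the program for circulations; `18`, `19` are scalars, and `30`,
`31` hold the scaled weights of the functional dependencies. -/

namespace SoftRepair

open RAM RAM.LoopProg UnitFlow

/-- The product of the value of an expression and `4`. -/
def fourTimes (e : Expr) : Expr := .add (.add e e) (.add e e)

/-- Entry `6 + 4 * e`, `7 + 4 * e`, `8 + 4 * e` or `9 + 4 * e` of the input: the constants, the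
numerator or the denominator of the weight of fact `e`. -/
def factCell (r : ℤ) (e : Expr) : Expr := .load 0 (.add (.const r) (fourTimes e))

theorem fourTimes_val (e : Expr) (σ : State) : (fourTimes e).val σ = 4 * e.val σ := by
  simp only [fourTimes, Expr.val]
  ring

theorem factCell_val (r : ℤ) (e : Expr) (σ : State) :
    (factCell r e).val σ = σ 0 (r + 4 * e.val σ) := by
  simp only [factCell, Expr.val, fourTimes_val]

/-! ### Clearing the denominators -/

/-- Multiplies the scalar `18` by the square of the denominator of the weight at `q`, unless this is
the weight at `p`. -/
def scaleBy (p q : Expr) : LoopProg :=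
  .ite (.eq p q) .skip (.store 18 (.const 0)
    (.mul (.mul (var 18) (.load 0 (.add q (.const 1)))) (.load 0 (.add q (.const 1)))))

/-- The factor of the scaled weight at `P` that is due to the weight at `Q`. -/
def factor (D : ℤ → ℤ) (P Q : ℤ) : ℤ := if P = Q then 1 else D (Q + 1) ^ 2

/-- The weight at `P`, multiplied by the squares of all denominators. -/
def scaled (D : ℤ → ℤ) (N : ℕ) (P : ℤ) : ℤ :=
  D P * D (P + 1) * factor D P 2 * factor D P 4 * ∏ j ∈ Finset.range N, factor D P (8 + 4 * j)

theorem run_scaleBy (p q : Expr) (σ : State) :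
    (scaleBy p q).run σ 18 0 = σ 18 0 * factor (σ 0) (p.val σ) (q.val σ) := by
  by_cases h : p.val σ = q.val σ
  · rw [scaleBy, run_ite_of_ne_zero (by simp [Expr.val, h])]
    simp [run, factor, h]
  · rw [scaleBy, run_ite_of_eq_zero (by simp [Expr.val, h])]
    simp [run, Expr.val, factor, h]
    ring

/-- Computes the scaled weight at `p`. -/
def scaleWeight (p : Expr) : LoopProg :=
  .store 18 (.const 0) (.mul (.load 0 p) (.load 0 (.add p (.const 1)))) ;;
  scaleBy p (.const 2) ;; scaleBy p (.const 4) ;;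
  .loop 22 (.ite (.lt (var 22) (.load 0 (.const 1)))
    (scaleBy p (.add (.const 8) (fourTimes (var 22)))) .skip)

theorem scaleBy_frame (p q : Expr) (σ : State) {b : ℕ} (hb : b ≠ 18) :
    (scaleBy p q).run σ b = σ b :=
  run_of_notMem (by simp [scaleBy, writes, hb]) σ

theorem run_scaleWeight {p : Expr} {σ : State} {M N : ℕ} {P : ℤ} (hM : σ 0 0 = M) (hN : σ 0 1 = N)
    (hNM : N ≤ M) (hp : ∀ τ : State, (∀ b, b ≠ 18 → b ≠ 22 → τ b = σ b) → p.val τ = P) :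
    (scaleWeight p).run σ 18 0 = scaled (σ 0) N P := by
  simp only [scaleWeight, run_seq]
  have h₁ : (LoopProg.store 18 (.const 0) (.mul (.load 0 p) (.load 0 (.add p (.const 1))))).run σ
      18 0 = σ 0 P * σ 0 (P + 1) := by
    simp [run, Expr.val, hp σ fun _ _ _ => rfl]
  have f₁ : ∀ b, b ≠ 18 → (LoopProg.store 18 (.const 0)
      (.mul (.load 0 p) (.load 0 (.add p (.const 1))))).run σ b = σ b := fun b hb =>
    run_of_notMem (by simp [writes, hb]) σ
  generalize (LoopProg.store 18 (.const 0)
    (.mul (.load 0 p) (.load 0 (.add p (.const 1))))).run σ = σ₁ at *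
  have h₂ := run_scaleBy p (.const 2) σ₁
  rw [h₁, f₁ 0 (by decide), hp σ₁ fun b hb _ => f₁ b hb] at h₂
  have f₂ : ∀ b, b ≠ 18 → (scaleBy p (.const 2)).run σ₁ b = σ b := fun b hb => by
    rw [scaleBy_frame _ _ _ hb, f₁ b hb]
  generalize (scaleBy p (.const 2)).run σ₁ = σ₂ at *
  have h₃ := run_scaleBy p (.const 4) σ₂
  rw [h₂, f₂ 0 (by decide), hp σ₂ fun b hb _ => f₂ b hb] at h₃
  have f₃ : ∀ b, b ≠ 18 → (scaleBy p (.const 4)).run σ₂ b = σ b := fun b hb => by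
    rw [scaleBy_frame _ _ _ hb, f₂ b hb]
  generalize (scaleBy p (.const 4)).run σ₂ = σ₃ at *
  -- All loops run `M` times; here the passes from `N` on are idle, hence `min t N`.
  have key := run_loop (fun t τ => τ 18 0 = σ 0 P * σ 0 (P + 1) * factor (σ 0) P 2 *
      factor (σ 0) P 4 * ∏ j ∈ Finset.range (min t N), factor (σ 0) P (8 + 4 * j))
    (σ := σ₃) (a := 22) (c := .ite (.lt (var 22) (.load 0 (.const 1)))
      (scaleBy p (.add (.const 8) (fourTimes (var 22)))) .skip) (m := M)
    (by rw [f₃ 0 (by decide), hM]) (by simpa [Expr.val] using h₃) (by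
      intro t ht τ hτ hf ih
      have hf' : ∀ b, b ≠ 18 → b ≠ 22 → τ b = σ b := fun b hb hb' => by
        rw [hf b hb' (by simp [scaleBy, writes, hb]), f₃ b hb]
      rw [State.write_ne _ _ _ (by decide)]
      by_cases h : t < N
      · rw [run_ite_of_ne_zero (by simp [Expr.val, hτ, hf', hN, h]), run_scaleBy, ih,
          min_eq_left h.le, min_eq_left h, Finset.prod_range_succ, hp τ hf',
          hf' 0 (by decide) (by decide)]
        simp only [Expr.val, fourTimes_val, hτ]
        ring
      · rw [run_ite_of_eq_zero (by simp [Expr.val, hτ, hf', hN, h]), run, ih,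
          min_eq_right (not_lt.1 h), min_eq_right (by omega)])
  rw [min_eq_right hNM] at key
  exact key

/-- The square of the product of all denominators. -/
def scale (D : ℤ → ℤ) (N : ℕ) : ℚ :=
  (D 3 : ℚ) ^ 2 * (D 5 : ℚ) ^ 2 * ∏ j ∈ Finset.range N, (D (9 + 4 * j) : ℚ) ^ 2

/-- At its own position a weight absorbs the square of its denominator, as numerator times
denominator, so no division is needed. -/
theorem scaled_eq {D : ℤ → ℤ} {N : ℕ} {P : ℤ} (hP : P = 2 ∨ P = 4 ∨ ∃ j < N, P = 8 + 4 * (j : ℕ))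
    (hD : D (P + 1) ≠ 0) : (scaled D N P : ℚ) = D P / D (P + 1) * scale D N := by
  have hD' : (D (P + 1) : ℚ) ≠ 0 := by exact_mod_cast hD
  have cong : ∀ j : ℕ, P ≠ 8 + 4 * j → factor D P (8 + 4 * j) = D (9 + 4 * j) ^ 2 := by
    intro j hj
    rw [factor, if_neg hj]
    ring_nf
  unfold scaled scale
  rcases hP with rfl | rfl | ⟨j, hj, rfl⟩
  · rw [Finset.prod_congr rfl fun j _ => cong j (by omega)]
    norm_num [factor] at hD' ⊢
    field_simp
  · rw [Finset.prod_congr rfl fun j _ => cong j (by omega)]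
    norm_num [factor] at hD' ⊢
    field_simp
  · rw [← Finset.mul_prod_erase _ _ (Finset.mem_range.2 hj),
      ← Finset.mul_prod_erase _ (fun j : ℕ => (D (9 + 4 * j) : ℚ) ^ 2) (Finset.mem_range.2 hj),
      Finset.prod_congr rfl fun i hi => cong i (by have := Finset.ne_of_mem_erase hi; omega)]
    have e : (8 + 4 * j + 1 : ℤ) = 9 + 4 * j := by ring
    rw [e] at hD' ⊢
    have n₂ : (8 + 4 * j : ℤ) ≠ 2 := by omega
    have n₄ : (8 + 4 * j : ℤ) ≠ 4 := by omega
    simp only [factor, n₂, n₄, if_true, if_false]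
    push_cast
    norm_num
    field_simp

theorem scale_pos {D : ℤ → ℤ} {N : ℕ} (h₃ : D 3 ≠ 0) (h₅ : D 5 ≠ 0)
    (h : ∀ j < N, D (9 + 4 * (j : ℕ)) ≠ 0) : 0 < scale D N := by
  have h₃' : (D 3 : ℚ) ≠ 0 := by exact_mod_cast h₃
  have h₅' : (D 5 : ℚ) ≠ 0 := by exact_mod_cast h₅
  refine mul_pos (by positivity) (Finset.prod_pos fun j hj => ?_)
  have : (D (9 + 4 * j) : ℚ) ≠ 0 := by exact_mod_cast h j (Finset.mem_range.1 hj)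
  positivity

/-! ### Building the network in the memory -/

/-- Computes the product of the scalar `w` and the rank of the fact `σ 20 0` among the facts with the
same entry `r`. -/
def rankCost (r : ℤ) (w : ℕ) : LoopProg :=
  .store 19 (.const 0) (.const 0) ;;
  .loop 22 (.ite (.lt (var 22) (var 20))
    (.ite (.eq (factCell r (var 22)) (factCell r (var 20)))
      (.store 19 (.const 0) (.add (var 19) (var w))) .skip) .skip)

/-- The product arises by repeated addition, since the scaled weight is not an input cell and a
multiplication by it would not be tame. -/
theorem run_rankCost {r : ℤ} {w : ℕ} {σ : State} {M N j : ℕ} {A : ℕ → ℕ} (hw : w ≠ 19) (hw' : w ≠ 22)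
    (hM : σ 0 0 = M) (hj : σ 20 0 = j) (hjN : j < N) (hNM : N ≤ M)
    (hA : ∀ i < N, σ 0 (r + 4 * (i : ℕ)) = A i) :
    (rankCost r w).run σ 19 0 = rank A (Finset.range N) j * σ w 0 := by
  rw [rankCost, run_seq]
  have h₁ : (LoopProg.store 19 (.const 0) (.const 0)).run σ 19 0 = 0 := by simp [run, Expr.val]
  have f₁ : ∀ b, b ≠ 19 → (LoopProg.store 19 (.const 0) (.const 0)).run σ b = σ b := fun b hb =>
    run_of_notMem (by simp [writes, hb]) σ
  generalize (LoopProg.store 19 (.const 0) (.const 0)).run σ = σ₁ at *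
  have key := run_loop (fun t τ => τ 19 0 = (rank A (Finset.range t) j : ℕ) * σ w 0)
    (σ := σ₁) (a := 22) (c := .ite (.lt (var 22) (var 20))
      (.ite (.eq (factCell r (var 22)) (factCell r (var 20)))
        (.store 19 (.const 0) (.add (var 19) (var w))) .skip) .skip) (m := M)
    (by rw [f₁ 0 (by decide), hM]) (by simpa [rank] using h₁) (by
      intro t ht τ hτ hf ih
      have hf' : ∀ b, b ≠ 19 → b ≠ 22 → τ b = σ b := fun b hb hb' => by
        rw [hf b hb' (by simp [writes, hb]), f₁ b hb]
      have h20 : τ 20 0 = j := by rw [hf' 20 (by decide) (by decide), hj]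
      have h0 : τ 0 = σ 0 := hf' 0 (by decide) (by decide)
      rw [State.write_ne _ _ _ (by decide), rank, Finset.range_add_one, Finset.filter_insert]
      by_cases h : t < j
      · rw [run_ite_of_ne_zero (by simp [Expr.val, hτ, h20, h])]
        by_cases h' : A t = A j
        · rw [run_ite_of_ne_zero (by
            simp [Expr.val, factCell_val, hτ, h20, h0, hA t (by omega), hA j hjN, h']),
            if_pos ⟨h, h'⟩, Finset.card_insert_of_notMem (by simp)]
          simp only [run, Expr.val, State.write_same, if_true, ih, hf' w hw hw', rank]
          push_cast
          ring
        · rw [run_ite_of_eq_zero (by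
            simp [Expr.val, factCell_val, hτ, h20, h0, hA t (by omega), hA j hjN, h']),
            if_neg fun e => h' e.2, run, ih, rank]
      · rw [run_ite_of_eq_zero (by simp [Expr.val, hτ, h20, h]), if_neg fun e => h e.1, run, ih,
          rank])
  -- Only indices below `j < N` contribute to the rank.
  have e : rank A (Finset.range M) j = rank A (Finset.range N) j := by
    unfold rank
    congr 1
    ext i
    simp only [Finset.mem_filter, Finset.mem_range]
    omega
  rw [← e]
  exact key

/-- The number `3 * σ 20 0 + r` of an arc. -/
def arcIndex (r : ℤ) : Expr := .add (.const r) (.add (var 20) (.add (var 20) (var 20)))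

theorem arcIndex_val (r : ℤ) (σ : State) : (arcIndex r).val σ = 3 * σ 20 0 + r := by
  simp only [arcIndex, Expr.val]
  ring

/-- The node of the first attribute of the fact `σ 20 0`. -/
def nodeA : Expr := .add (.const 1) (.add (factCell 6 (var 20)) (factCell 6 (var 20)))

/-- The node of the second attribute of the fact `σ 20 0`. -/
def nodeB : Expr := .add (.const 2) (.add (factCell 7 (var 20)) (factCell 7 (var 20)))

theorem nodeA_val (σ : State) : nodeA.val σ = 2 * σ 0 (6 + 4 * σ 20 0) + 1 := by
  simp only [nodeA, Expr.val, factCell_val]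
  ring

theorem nodeB_val (σ : State) : nodeB.val σ = 2 * σ 0 (7 + 4 * σ 20 0) + 2 := by
  simp only [nodeB, Expr.val, factCell_val]
  ring

/-- A loop with counter `20` over all facts. -/
def forFacts (c : LoopProg) : LoopProg := .loop 20 (.ite (.lt (var 20) (.load 0 (.const 1))) c .skip)

/-- The passes from `N` on do nothing, so the invariant is carried at `min t N`. By `hInv` it
ignores the writes to the counter between the passes. -/
theorem run_forFacts {c : LoopProg} {σ : State} (Inv : ℕ → State → Prop) {M N : ℕ} (hM : σ 0 0 = M)
    (hN : σ 0 1 = N) (hNM : N ≤ M) (h0 : 0 ∉ c.writes) (zero : Inv 0 (σ.write 20 0 0))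
    (hInv : ∀ t τ z, Inv t τ → Inv t (State.write τ 20 0 z))
    (succ : ∀ t < N, ∀ τ : State, τ 20 0 = t → (∀ b, b ≠ 20 → b ∉ c.writes → τ b = σ b) →
      Inv t τ → Inv (t + 1) (c.run τ)) : Inv N ((forFacts c).run σ) := by
  have key := run_loop (a := 20) (c := .ite (.lt (var 20) (.load 0 (.const 1))) c .skip)
    (fun t τ => Inv (min t N) τ) hM (by simpa using zero) (by
      intro t ht τ hτ hf ih
      have hf' : ∀ b, b ≠ 20 → b ∉ c.writes → τ b = σ b := fun b hb hb' =>
        hf b hb (by simp [writes, hb'])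
      apply hInv
      by_cases h : t < N
      · rw [run_ite_of_ne_zero (by simp [Expr.val, hτ, hf' 0 (by decide) h0, hN, h]),
          min_eq_left h]
        rw [min_eq_left h.le] at ih
        exact succ t h τ hτ hf' ih
      · rw [run_ite_of_eq_zero (by simp [Expr.val, hτ, hf' 0 (by decide) h0, hN, h]),
          min_eq_right (by omega)]
        rwa [min_eq_right (by omega)] at ih)
  rwa [min_eq_right hNM] at key

/-- Writes the ends of the arcs. -/
def buildEnds : LoopProg := forFacts
  (.store 2 (arcIndex 0) (.const 0) ;; .store 2 (arcIndex 1) nodeA ;; .store 2 (arcIndex 2) nodeB ;;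
    .store 3 (arcIndex 0) nodeA ;; .store 3 (arcIndex 1) nodeB ;; .store 3 (arcIndex 2) (.const 0))

theorem run_buildEnds {σ : State} {M N : ℕ} {A B : ℕ → ℕ} (hM : σ 0 0 = M) (hN : σ 0 1 = N)
    (hNM : N ≤ M) (hA : ∀ i < N, σ 0 (6 + 4 * (i : ℕ)) = A i)
    (hB : ∀ i < N, σ 0 (7 + 4 * (i : ℕ)) = B i) (h2 : ∀ i, σ 2 i = 0) (h3 : ∀ i, σ 3 i = 0) :
    (∀ j < N, buildEnds.run σ 2 (3 * (j : ℕ)) = 0 ∧ buildEnds.run σ 2 (3 * j + 1) = 2 * A j + 1 ∧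
      buildEnds.run σ 2 (3 * j + 2) = 2 * B j + 2 ∧ buildEnds.run σ 3 (3 * j) = 2 * A j + 1 ∧
      buildEnds.run σ 3 (3 * j + 1) = 2 * B j + 2 ∧ buildEnds.run σ 3 (3 * j + 2) = 0) ∧
    ∀ i : ℕ, 3 * N ≤ i → buildEnds.run σ 2 i = 0 ∧ buildEnds.run σ 3 i = 0 := by
  refine run_forFacts (fun t τ => (∀ j < t, τ 2 (3 * (j : ℕ)) = 0 ∧ τ 2 (3 * j + 1) = 2 * A j + 1 ∧
      τ 2 (3 * j + 2) = 2 * B j + 2 ∧ τ 3 (3 * j) = 2 * A j + 1 ∧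
      τ 3 (3 * j + 1) = 2 * B j + 2 ∧ τ 3 (3 * j + 2) = 0) ∧
    ∀ i : ℕ, 3 * N ≤ i → τ 2 i = 0 ∧ τ 3 i = 0) hM hN hNM (by decide) (by simp [h2, h3])
    (fun t τ z h => by simpa using h) ?_
  rintro t ht τ hτ hf ⟨i₁, i₂⟩
  have h0 : τ 0 = σ 0 := hf 0 (by decide) (by decide)
  simp only [run, arcIndex_val, nodeA_val, nodeB_val, Expr.val, ne_eq, Nat.reduceEqDiff,
    not_false_eq_true, State.write_ne, State.write_same, hτ, h0, hA t ht, hB t ht,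
    OfNat.zero_ne_ofNat]
  refine ⟨fun j hj => ?_, fun i hi => ?_⟩
  · rcases Nat.lt_succ_iff_lt_or_eq.1 hj with hj | rfl
    · obtain ⟨a₁, a₂, a₃, a₄, a₅, a₆⟩ := i₁ j hj
      refine ⟨?_, ?_, ?_, ?_, ?_, ?_⟩
      · rw [if_neg (by omega), if_neg (by omega), if_neg (by omega), a₁]
      · rw [if_neg (by omega), if_neg (by omega), if_neg (by omega), a₂]
      · rw [if_neg (by omega), if_neg (by omega), if_neg (by omega), a₃]
      · rw [if_neg (by omega), if_neg (by omega), if_neg (by omega), a₄]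
      · rw [if_neg (by omega), if_neg (by omega), if_neg (by omega), a₅]
      · rw [if_neg (by omega), if_neg (by omega), if_neg (by omega), a₆]
    · simp
  · constructor
    · rw [if_neg (by omega), if_neg (by omega), if_neg (by omega), (i₂ i hi).1]
    · rw [if_neg (by omega), if_neg (by omega), if_neg (by omega), (i₂ i hi).2]

/-- Writes the costs of the arcs. -/
def buildCosts : LoopProg := forFacts
  (scaleWeight (.add (.const 8) (fourTimes (var 20))) ;;
    .store 4 (arcIndex 1) (.sub (.const 0) (var 18)) ;;
    rankCost 6 30 ;; .store 4 (arcIndex 0) (var 19) ;;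
    rankCost 7 31 ;; .store 4 (arcIndex 2) (var 19))

theorem run_buildCosts {σ : State} {M N : ℕ} {A B : ℕ → ℕ} (hM : σ 0 0 = M) (hN : σ 0 1 = N)
    (hNM : N ≤ M) (hA : ∀ i < N, σ 0 (6 + 4 * (i : ℕ)) = A i)
    (hB : ∀ i < N, σ 0 (7 + 4 * (i : ℕ)) = B i) (h4 : ∀ i, σ 4 i = 0) :
    (∀ j < N, buildCosts.run σ 4 (3 * (j : ℕ)) = rank A (Finset.range N) j * σ 30 0 ∧
      buildCosts.run σ 4 (3 * j + 1) = -scaled (σ 0) N (8 + 4 * j) ∧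
      buildCosts.run σ 4 (3 * j + 2) = rank B (Finset.range N) j * σ 31 0) ∧
    ∀ i : ℕ, 3 * N ≤ i → buildCosts.run σ 4 i = 0 := by
  refine run_forFacts (fun t τ =>
    (∀ j < t, τ 4 (3 * (j : ℕ)) = rank A (Finset.range N) j * σ 30 0 ∧
      τ 4 (3 * j + 1) = -scaled (σ 0) N (8 + 4 * j) ∧
      τ 4 (3 * j + 2) = rank B (Finset.range N) j * σ 31 0) ∧
    ∀ i : ℕ, 3 * N ≤ i → τ 4 i = 0) hM hN hNM (by decide) (by simp [h4])
    (fun t τ z h => by simpa using h) ?_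
  rintro t ht τ hτ hf ⟨i₁, i₂⟩
  have h0 : τ 0 = σ 0 := hf 0 (by decide) (by decide)
  have h30 : τ 30 = σ 30 := hf 30 (by decide) (by decide)
  have h31 : τ 31 = σ 31 := hf 31 (by decide) (by decide)
  have g₁ := run_scaleWeight (σ := τ) (p := .add (.const 8) (fourTimes (var 20)))
    (P := 8 + 4 * t) (by rw [h0, hM]) (by rw [h0, hN]) hNM
    fun τ' h => by simp [Expr.val, fourTimes_val, h, hτ]
  simp only [run_seq]
  have f₁ : ∀ b ∈ ({0, 4, 20, 30, 31} : Finset ℕ),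
      (scaleWeight (.add (.const 8) (fourTimes (var 20)))).run τ b = τ b := fun b hb =>
    run_of_notMem ((by decide : ∀ b ∈ ({0, 4, 20, 30, 31} : Finset ℕ),
      b ∉ (scaleWeight (.add (.const 8) (fourTimes (var 20)))).writes) b hb) _
  generalize (scaleWeight (.add (.const 8) (fourTimes (var 20)))).run τ = τ₁ at *
  have g₂ : (LoopProg.store 4 (arcIndex 1) (.sub (.const 0) (var 18))).run τ₁ =
      τ₁.write 4 (3 * t + 1) (-scaled (σ 0) N (8 + 4 * t)) := by
    simp [run, arcIndex_val, Expr.val, f₁, hτ, g₁, h0]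
  rw [g₂]
  obtain ⟨τ₂, hτ₂⟩ : ∃ τ₂, τ₁.write 4 (3 * t + 1) (-scaled (σ 0) N (8 + 4 * t)) = τ₂ := ⟨_, rfl⟩
  rw [hτ₂]
  have f₂ : ∀ b ∈ ({0, 20, 30, 31} : Finset ℕ), τ₂ b = τ b := fun b hb => by
    rw [← hτ₂, State.write_ne _ _ _ ((by decide : ∀ b ∈ ({0, 20, 30, 31} : Finset ℕ), b ≠ 4) b hb),
      f₁ b ((by decide : ({0, 20, 30, 31} : Finset ℕ) ⊆ {0, 4, 20, 30, 31}) hb)]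
  have e₂ : τ₂ 4 = Function.update (τ 4) (3 * t + 1) (-scaled (σ 0) N (8 + 4 * t)) := by
    rw [← hτ₂, State.write_same', f₁ 4 (by decide)]
  have g₃ := run_rankCost (σ := τ₂) (r := 6) (w := 30) (N := N) (M := M) (j := t) (A := A)
    (by decide) (by decide) (by rw [f₂ 0 (by decide), h0, hM]) (by rw [f₂ 20 (by decide), hτ]) ht hNM
    (by rw [f₂ 0 (by decide), h0]; exact hA)
  rw [f₂ 30 (by decide), h30] at g₃
  have f₃ : ∀ b ∈ ({0, 4, 20, 31} : Finset ℕ), (rankCost 6 30).run τ₂ b = τ₂ b := fun b hb =>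
    run_of_notMem ((by decide : ∀ b ∈ ({0, 4, 20, 31} : Finset ℕ), b ∉ (rankCost 6 30).writes) b hb) _
  generalize (rankCost 6 30).run τ₂ = τ₃ at *
  have g₄ : (LoopProg.store 4 (arcIndex 0) (var 19)).run τ₃ =
      τ₃.write 4 (3 * t) (rank A (Finset.range N) t * σ 30 0) := by
    simp [run, arcIndex_val, Expr.val, f₃, f₂, hτ, g₃]
  rw [g₄]
  obtain ⟨τ₄, hτ₄⟩ : ∃ τ₄, τ₃.write 4 (3 * t) (rank A (Finset.range N) t * σ 30 0) = τ₄ := ⟨_, rfl⟩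
  rw [hτ₄]
  have f₄ : ∀ b ∈ ({0, 20, 31} : Finset ℕ), τ₄ b = τ b := fun b hb => by
    rw [← hτ₄, State.write_ne _ _ _ ((by decide : ∀ b ∈ ({0, 20, 31} : Finset ℕ), b ≠ 4) b hb),
      f₃ b ((by decide : ({0, 20, 31} : Finset ℕ) ⊆ {0, 4, 20, 31}) hb),
      f₂ b ((by decide : ({0, 20, 31} : Finset ℕ) ⊆ {0, 20, 30, 31}) hb)]
  have e₄ : τ₄ 4 = Function.update (τ₂ 4) (3 * t) (rank A (Finset.range N) t * σ 30 0) := by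
    rw [← hτ₄, State.write_same', f₃ 4 (by decide)]
  have g₅ := run_rankCost (σ := τ₄) (r := 7) (w := 31) (N := N) (M := M) (j := t) (A := B)
    (by decide) (by decide) (by rw [f₄ 0 (by decide), h0, hM]) (by rw [f₄ 20 (by decide), hτ]) ht hNM
    (by rw [f₄ 0 (by decide), h0]; exact hB)
  rw [f₄ 31 (by decide), h31] at g₅
  have f₅ : ∀ b ∈ ({4, 20} : Finset ℕ), (rankCost 7 31).run τ₄ b = τ₄ b := fun b hb =>
    run_of_notMem ((by decide : ∀ b ∈ ({4, 20} : Finset ℕ), b ∉ (rankCost 7 31).writes) b hb) _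
  generalize (rankCost 7 31).run τ₄ = τ₅ at *
  have e₆ : (LoopProg.store 4 (arcIndex 2) (var 19)).run τ₅ 4 =
      Function.update (τ₄ 4) (3 * t + 2) (rank B (Finset.range N) t * σ 31 0) := by
    simp [run, arcIndex_val, Expr.val, f₅, f₄, hτ, g₅, State.write_same']
  simp only [e₆, e₄, e₂, Function.update_apply]
  refine ⟨fun j hj => ?_, fun i hi => ?_⟩
  · rcases Nat.lt_succ_iff_lt_or_eq.1 hj with hj | rfl
    · obtain ⟨a₁, a₂, a₃⟩ := i₁ j hj
      refine ⟨?_, ?_, ?_⟩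
      · rw [if_neg (by omega), if_neg (by omega), if_neg (by omega), a₁]
      · rw [if_neg (by omega), if_neg (by omega), if_neg (by omega), a₂]
      · rw [if_neg (by omega), if_neg (by omega), if_neg (by omega), a₃]
    · refine ⟨?_, ?_, ?_⟩
      · rw [if_neg (by omega), if_pos rfl]
      · rw [if_neg (by omega), if_neg (by omega), if_pos rfl]
      · rw [if_pos rfl]
  · rw [if_neg (by omega), if_neg (by omega), if_neg (by omega), i₂ i hi]

/-! ### The output and the whole program -/

/-- Writes the characteristic vector of the kept facts. -/
def writeOutput : LoopProg :=
  .store 1 (.const 0) (.load 0 (.const 1)) ;;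
  forFacts (.store 1 (.add (var 20) (.const 1)) (.load 5 (arcIndex 1)))

theorem run_writeOutput {σ : State} {M N : ℕ} (hM : σ 0 0 = M) (hN : σ 0 1 = N) (hNM : N ≤ M) :
    output (writeOutput.run σ) = List.ofFn fun j : Fin N => σ 5 (3 * (j : ℕ) + 1) := by
  have h₀ : (LoopProg.store 1 (.const 0) (.load 0 (.const 1))).run σ = σ.write 1 0 N := by
    simp [run, Expr.val, hN]
  have key := run_forFacts (c := .store 1 (.add (var 20) (.const 1)) (.load 5 (arcIndex 1)))
    (σ := σ.write 1 0 N)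
    (fun t τ => τ 1 0 = N ∧ ∀ j < t, τ 1 ((j : ℕ) + 1) = σ 5 (3 * (j : ℕ) + 1)) (M := M) (N := N)
    (by simpa) (by simpa) hNM (by decide) (by simp) (fun t τ z h => by simpa using h) (by
      rintro t ht τ hτ hf ⟨i₁, i₂⟩
      have h5 : τ 5 = σ 5 := by
        rw [hf 5 (by decide) (by decide), State.write_ne _ _ _ (by decide)]
      simp only [run, Expr.val, arcIndex_val, hτ, State.write_same, h5]
      refine ⟨by rw [if_neg (by omega), i₁], fun j hj => ?_⟩
      rcases Nat.lt_succ_iff_lt_or_eq.1 hj with hj | rfl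
      · rw [if_neg (by omega), i₂ j hj]
      · rw [if_pos rfl])
  rw [writeOutput, run_seq, h₀]
  generalize (forFacts (.store 1 (.add (var 20) (.const 1)) (.load 5 (arcIndex 1)))).run
    (σ.write 1 0 N) = τ at *
  obtain ⟨k₁, k₂⟩ := key
  refine List.ext_getElem (by simp [output, k₁]) fun j h₁ h₂ => ?_
  simp only [List.length_ofFn] at h₂
  simp [output, k₂ j h₂]

/-- The program for soft repairing. -/
def repair : LoopProg :=
  scaleWeight (.const 2) ;; .store 30 (.const 0) (var 18) ;;
  scaleWeight (.const 4) ;; .store 31 (.const 0) (var 18) ;;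
  buildEnds ;; buildCosts ;; solve ;; writeOutput

theorem scaleWeight_tame {p : Expr} (hp : p.Tame) : (scaleWeight p).Tame := by
  simp [scaleWeight, scaleBy, Tame, Expr.Tame, fourTimes, writes, hp]

theorem repair_tame : repair.Tame := by
  refine ⟨scaleWeight_tame trivial, ?_, scaleWeight_tame trivial, ?_, ?_, ?_, ?_, ?_⟩
  · simp [Tame, Expr.Tame]
  · simp [Tame, Expr.Tame]
  · simp [buildEnds, forFacts, nodeA, nodeB, arcIndex, factCell, fourTimes, Tame, Expr.Tame, writes]
  · refine ⟨by decide, by decide, by simp [Expr.Tame], ⟨scaleWeight_tame ?_, ?_⟩, trivial⟩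
    · simp [Expr.Tame, fourTimes]
    · simp [rankCost, arcIndex, factCell, fourTimes, Tame, Expr.Tame, writes]
  · refine ⟨by decide, by decide, ?_⟩
    simp [insertArc, startSearch, setBound, clearMarks, copyBlock, searchRound, findArc, compareArc,
      markArc, augment, raiseNodes, raiseNode, Tame, Expr.Tame, writes]
  · simp [writeOutput, forFacts, arcIndex, Tame, Expr.Tame, writes]

/-- The program finds an optimal set of facts. -/
theorem run_repair {σ : State} {M N : ℕ} {A B : ℕ → ℕ} (hM : σ 0 0 = M) (hN : σ 0 1 = N)
    (hNM : 3 * N ≤ M) (hσ : ∀ a, a ≠ 0 → ∀ i, σ a i = 0)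
    (hA : ∀ i < N, σ 0 (6 + 4 * (i : ℕ)) = A i) (hB : ∀ i < N, σ 0 (7 + 4 * (i : ℕ)) = B i)
    (h₁ : 0 ≤ scaled (σ 0) N 2) (h₂ : 0 ≤ scaled (σ 0) N 4) :
    ∃ X ⊆ Finset.range N,
      output (repair.run σ) = List.ofFn (fun j : Fin N => if (j : ℕ) ∈ X then 1 else 0) ∧
      ∀ X' ⊆ Finset.range N,
        keepCost N A B (fun j => scaled (σ 0) N (8 + 4 * j)) (scaled (σ 0) N 2) (scaled (σ 0) N 4) X ≤
        keepCost N A B (fun j => scaled (σ 0) N (8 + 4 * j)) (scaled (σ 0) N 2) (scaled (σ 0) N 4)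
          X' := by
  have hNM' : N ≤ M := by omega
  simp only [repair, run_seq]
  have g₁ := run_scaleWeight (p := .const 2) hM hN hNM' fun _ _ => rfl
  have f₁ : ∀ b, b ≠ 18 → b ≠ 22 → (scaleWeight (.const 2)).run σ b = σ b := fun b h h' =>
    run_of_notMem (by simp [scaleWeight, scaleBy, writes, h, h']) _
  generalize (scaleWeight (.const 2)).run σ = σ₁ at *
  have g₂ : (LoopProg.store 30 (.const 0) (var 18)).run σ₁ 30 0 = scaled (σ 0) N 2 := by
    simp [run, Expr.val, g₁]
  have f₂ : ∀ b, b ≠ 18 → b ≠ 22 → b ≠ 30 →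
      (LoopProg.store 30 (.const 0) (var 18)).run σ₁ b = σ b := fun b h h' h'' => by
    rw [run_of_notMem (by simp [writes, h'']), f₁ b h h']
  generalize (LoopProg.store 30 (.const 0) (var 18)).run σ₁ = σ₂ at *
  have e₂ : σ₂ 0 = σ 0 := f₂ 0 (by decide) (by decide) (by decide)
  have g₃ := run_scaleWeight (σ := σ₂) (p := .const 4) (by rw [e₂, hM]) (by rw [e₂, hN]) hNM'
    fun _ _ => rfl
  rw [e₂] at g₃
  have f₃ : ∀ b, b ≠ 18 → b ≠ 22 → (scaleWeight (.const 4)).run σ₂ b = σ₂ b := fun b h h' =>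
    run_of_notMem (by simp [scaleWeight, scaleBy, writes, h, h']) _
  generalize (scaleWeight (.const 4)).run σ₂ = σ₃ at *
  have g₄ : (LoopProg.store 31 (.const 0) (var 18)).run σ₃ 31 0 = scaled (σ 0) N 4 := by
    simp [run, Expr.val, g₃]
  have g₄' : (LoopProg.store 31 (.const 0) (var 18)).run σ₃ 30 0 = scaled (σ 0) N 2 := by
    rw [run_of_notMem (by decide), f₃ 30 (by decide) (by decide), g₂]
  have f₄ : ∀ b, b ≠ 18 → b ≠ 22 → b ≠ 30 → b ≠ 31 →
      (LoopProg.store 31 (.const 0) (var 18)).run σ₃ b = σ b := fun b h h' h'' h₃ => by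
    rw [run_of_notMem (by simp [writes, h₃]), f₃ b h h', f₂ b h h' h'']
  generalize (LoopProg.store 31 (.const 0) (var 18)).run σ₃ = σ₄ at *
  have e₄ : σ₄ 0 = σ 0 := f₄ 0 (by decide) (by decide) (by decide) (by decide)
  obtain ⟨p₁, p₂⟩ := run_buildEnds (σ := σ₄) (M := M) (N := N) (A := A) (B := B) (by rw [e₄, hM])
    (by rw [e₄, hN]) hNM' (by rwa [e₄]) (by rwa [e₄])
    (by rw [f₄ 2 (by decide) (by decide) (by decide) (by decide)]; exact hσ 2 (by decide))
    (by rw [f₄ 3 (by decide) (by decide) (by decide) (by decide)]; exact hσ 3 (by decide))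
  have f₅ : ∀ b ∈ ({0, 4, 7, 30, 31} : Finset ℕ), buildEnds.run σ₄ b = σ₄ b := fun b hb =>
    run_of_notMem ((by decide : ∀ b ∈ ({0, 4, 7, 30, 31} : Finset ℕ), b ∉ buildEnds.writes) b hb) _
  generalize buildEnds.run σ₄ = σ₅ at *
  have e₅ : σ₅ 0 = σ 0 := by rw [f₅ 0 (by decide), e₄]
  obtain ⟨q₁, q₂⟩ := run_buildCosts (σ := σ₅) (M := M) (N := N) (A := A) (B := B) (by rw [e₅, hM])
    (by rw [e₅, hN]) hNM' (by rwa [e₅]) (by rwa [e₅]) (by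
      rw [f₅ 4 (by decide), f₄ 4 (by decide) (by decide) (by decide) (by decide)]
      exact hσ 4 (by decide))
  rw [f₅ 30 (by decide), f₅ 31 (by decide), g₄, g₄', e₅] at q₁
  have f₆ : ∀ b ∈ ({0, 2, 3, 7} : Finset ℕ), buildCosts.run σ₅ b = σ₅ b := fun b hb =>
    run_of_notMem ((by decide : ∀ b ∈ ({0, 2, 3, 7} : Finset ℕ), b ∉ buildCosts.writes) b hb) _
  generalize buildCosts.run σ₅ = σ₆ at *
  have e₆ : σ₆ 0 = σ 0 := by rw [f₆ 0 (by decide), e₅]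
  have net : IsNetwork N A B (fun j => scaled (σ 0) N (8 + 4 * j)) (scaled (σ 0) N 2)
      (scaled (σ 0) N 4) (σ₆ 2) (σ₆ 3) (σ₆ 4) := by
    rw [f₆ 2 (by decide), f₆ 3 (by decide)]
    exact ⟨fun j hj => (p₁ j hj).1, fun j hj => (p₁ j hj).2.2.2.1, fun j hj => (q₁ j hj).1,
      fun j hj => (p₁ j hj).2.1, fun j hj => (p₁ j hj).2.2.2.2.1, fun j hj => (q₁ j hj).2.1,
      fun j hj => (p₁ j hj).2.2.1, fun j hj => (p₁ j hj).2.2.2.2.2, fun j hj => (q₁ j hj).2.2,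
      fun i hi => ⟨(p₂ i hi).1, (p₂ i hi).2, q₂ i hi⟩⟩
  have cert := run_solve (σ := σ₆) (M := M) (by rw [e₆, hM]) (by
    rw [f₆ 7 (by decide), f₅ 7 (by decide), f₄ 7 (by decide) (by decide) (by decide) (by decide)]
    exact hσ 7 (by decide))
  have e₇ : solve.run σ₆ 0 = σ 0 := by rw [run_of_notMem (by decide), e₆]
  generalize solve.run σ₆ = σ₇ at *
  refine ⟨kept N (σ₇ 5), Finset.filter_subset _ _, ?_, fun X' hX' =>
    net.keepCost_le hNM h₁ h₂ cert hX'⟩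
  rw [run_writeOutput (M := M) (N := N) (by rw [e₇, hM]) (by rw [e₇, hN]) hNM']
  congr 1
  funext j
  have hj := cert.1 (3 * j + 1) (by omega)
  push_cast at hj
  rcases hj.eq_zero_or_one with h | h <;> simp [kept, h]

end SoftRepair

/-! ### From the encoded instance to sets of indices -/

namespace SoftRepair

open RAM RAM.LoopProg UnitFlow

theorem getD_flatMap {α : Type*} {g : α → List ℤ} {m : ℕ} (hg : ∀ a, (g a).length = m) (l : List α)
    {j r : ℕ} (hj : j < l.length) (hr : r < m) :
    (l.flatMap g).getD (m * j + r) 0 = (g l[j]).getD r 0 := by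
  induction l generalizing j with
  | nil => simp at hj
  | cons a l ih =>
    rw [List.flatMap_cons]
    cases j with
    | zero =>
      rw [List.getD_append _ _ _ _ (by rw [hg]; omega)]
      simp
    | succ j =>
      have e : m * (j + 1) + r = m + (m * j + r) := by ring
      rw [List.getD_append_right _ _ _ _ (by rw [hg, e]; omega), hg, e, Nat.add_sub_cancel_left,
        ih (by simpa using hj)]
      rfl

/-- The dependencies `A → B` and `B → A`. -/
abbrev bothFDs : List (FD 2) := [⟨{attrA}, {attrB}⟩, ⟨{attrB}, {attrA}⟩]

namespace Instance

/-- Fact number `j` of an instance. -/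
def fact (I : Instance 2) (j : ℕ) : Fact 2 := I.facts.getD j fun _ => 0

variable (I : Instance 2)

theorem fact_eq {j : ℕ} (hj : j < I.facts.length) : I.fact j = I.facts[j] :=
  List.getD_eq_getElem _ _ hj

theorem fact_injOn : Set.InjOn I.fact (Finset.range I.facts.length) := by
  intro i hi j hj e
  rw [Finset.coe_range, Set.mem_Iio] at hi hj
  rw [fact_eq I hi, fact_eq I hj] at e
  exact (List.Nodup.getElem_inj_iff I.nodup).1 e

theorem image_fact : (Finset.range I.facts.length).image I.fact = I.database := by
  ext f
  simp only [Finset.mem_image, Finset.mem_range, database, List.mem_toFinset]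
  constructor
  · rintro ⟨j, hj, rfl⟩
    rw [fact_eq I hj]
    exact List.getElem_mem hj
  · intro hf
    obtain ⟨j, hj, rfl⟩ := List.getElem_of_mem hf
    exact ⟨j, hj, fact_eq I hj⟩

/-- This is the bound `M` of all loops; it exceeds the number `3 * N` of arcs. -/
theorem length_encode : (I.encode bothFDs).length = 4 * I.facts.length + 5 := by
  simp [encode]
  ring

/-- Cell `0` holds the length of the input, cell `1` the number of facts and cells `2` to `5` the
weights of the dependencies; blocks of four cells, one for each fact, begin at cell `6`. -/
theorem init_fact {j r : ℕ} (hj : j < I.facts.length) (hr : r < 4) :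
    init (I.encode bothFDs) 0 ((6 + r : ℕ) + 4 * (j : ℕ)) =
      [(I.fact j 0 : ℤ), (I.fact j 1 : ℤ), (I.factWeight (I.fact j)).num,
        (I.factWeight (I.fact j)).den].getD r 0 := by
  have h : 0 ≤ (((6 + r : ℕ) : ℤ) + 4 * (j : ℕ)) := by omega
  have e : (((6 + r : ℕ) : ℤ) + 4 * (j : ℕ)).toNat = 4 * j + r + 6 := by omega
  rw [init, if_pos ⟨rfl, h⟩, e]
  simp only [encode, List.flatMap_cons, List.flatMap_nil, List.append_nil, List.cons_append,
    List.nil_append, List.getD_cons_succ]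
  rw [getD_flatMap (m := 4) (fun f => by simp) _ hj hr, fact_eq I hj]
  simp

/-- The cost of a set of facts in terms of their indices. -/
theorem cost_image {X : Finset ℕ} (hX : X ⊆ Finset.range I.facts.length) (w : Fact 2 → ℚ)
    (w' : FD 2 → ℚ) {W : ℕ → ℤ} {W₁ W₂ : ℤ} {S : ℚ}
    (hW : ∀ j < I.facts.length, (W j : ℚ) = w (I.fact j) * S)
    (h₁ : (W₁ : ℚ) = w' ⟨{attrA}, {attrB}⟩ * S) (h₂ : (W₂ : ℚ) = w' ⟨{attrB}, {attrA}⟩ * S) :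
    cost bothFDs.toFinset w w' I.database (X.image I.fact) * S =
      keepCost I.facts.length (fun j => I.fact j 0) (fun j => I.fact j 1) W W₁ W₂ X := by
  have hinj := I.fact_injOn
  have hsub : (X : Set ℕ) ⊆ Finset.range I.facts.length := Finset.coe_subset.2 hX
  have hd : I.database \ X.image I.fact =
      (Finset.range I.facts.length \ X).image I.fact := by
    rw [← image_fact]
    ext f
    simp only [Finset.mem_sdiff, Finset.mem_image]
    constructor
    · rintro ⟨⟨j, hj, rfl⟩, h⟩
      exact ⟨j, ⟨hj, fun hj' => h ⟨j, hj', rfl⟩⟩, rfl⟩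
    · rintro ⟨j, ⟨hj, hj'⟩, rfl⟩
      refine ⟨⟨j, hj, rfl⟩, ?_⟩
      rintro ⟨i, hi, e⟩
      exact hj' (hinj (hX hi) hj e ▸ hi)
  have hne : (⟨{attrA}, {attrB}⟩ : FD 2) ∉ ({⟨{attrB}, {attrA}⟩} : Finset (FD 2)) := by decide
  rw [cost, hd, Finset.sum_image (hinj.mono (by simp)), List.toFinset_cons, List.toFinset_cons,
    List.toFinset_nil, insert_empty_eq, Finset.sum_insert hne, Finset.sum_singleton,
    card_vio (hinj.mono hsub) (by decide), card_vio (hinj.mono hsub) (by decide), keepCost]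
  push_cast
  rw [h₁, h₂, Finset.sum_congr rfl (g := fun j => w (I.fact j) * S) fun j hj =>
    hW j (Finset.mem_range.1 (Finset.mem_sdiff.1 hj).1), ← Finset.sum_mul]
  ring

end Instance

/-- The program for soft repairing is correct. -/
theorem repair_correct (I : Instance 2) :
    ∃ X ⊆ Finset.range I.facts.length,
      output (repair.run (init (I.encode bothFDs))) =
        List.ofFn (fun j : Fin I.facts.length => if (j : ℕ) ∈ X then 1 else 0) ∧
      IsOptimalSubset bothFDs.toFinset (fun f => (I.factWeight f).val) (fun φ => (I.fdWeight φ).val)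
        I.database (X.image I.fact) := by
  set N := I.facts.length with hN
  obtain ⟨σ, hσ⟩ : ∃ σ, init (I.encode bothFDs) = σ := ⟨_, rfl⟩
  have d2 : σ 0 2 = (I.fdWeight ⟨{attrA}, {attrB}⟩).num := by rw [← hσ]; rfl
  have d3 : σ 0 3 = (I.fdWeight ⟨{attrA}, {attrB}⟩).den := by rw [← hσ]; rfl
  have d4 : σ 0 4 = (I.fdWeight ⟨{attrB}, {attrA}⟩).num := by rw [← hσ]; rfl
  have d5 : σ 0 5 = (I.fdWeight ⟨{attrB}, {attrA}⟩).den := by rw [← hσ]; rfl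
  have dA : ∀ j < N, σ 0 (6 + 4 * (j : ℕ)) = I.fact j 0 := fun j hj => by
    rw [← hσ]; exact I.init_fact (r := 0) hj (by norm_num)
  have dB : ∀ j < N, σ 0 (7 + 4 * (j : ℕ)) = I.fact j 1 := fun j hj => by
    rw [← hσ]; exact I.init_fact (r := 1) hj (by norm_num)
  have d8 : ∀ j < N, σ 0 (8 + 4 * (j : ℕ)) = (I.factWeight (I.fact j)).num := fun j hj => by
    rw [← hσ]; exact I.init_fact (r := 2) hj (by norm_num)
  have d9 : ∀ j < N, σ 0 (9 + 4 * (j : ℕ)) = (I.factWeight (I.fact j)).den := fun j hj => by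
    rw [← hσ]; exact I.init_fact (r := 3) hj (by norm_num)
  have hS : 0 < scale (σ 0) N := scale_pos (by rw [d3]; exact Weight.den_ne_zero _)
    (by rw [d5]; exact Weight.den_ne_zero _) fun j hj => by rw [d9 j hj]; exact Weight.den_ne_zero _
  have s₁ : (scaled (σ 0) N 2 : ℚ) = (I.fdWeight ⟨{attrA}, {attrB}⟩).val * scale (σ 0) N := by
    rw [scaled_eq (Or.inl rfl)]
    · norm_num [d2, d3, Weight.val]
    · norm_num [d3, Weight.den_ne_zero]
  have s₂ : (scaled (σ 0) N 4 : ℚ) = (I.fdWeight ⟨{attrB}, {attrA}⟩).val * scale (σ 0) N := by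
    rw [scaled_eq (Or.inr (Or.inl rfl))]
    · norm_num [d4, d5, Weight.val]
    · norm_num [d5, Weight.den_ne_zero]
  have s₃ : ∀ j < N, (scaled (σ 0) N (8 + 4 * j) : ℚ) =
      (I.factWeight (I.fact j)).val * scale (σ 0) N := by
    intro j hj
    have e : (8 + 4 * j + 1 : ℤ) = 9 + 4 * j := by ring
    rw [scaled_eq (Or.inr (Or.inr ⟨j, hj, rfl⟩)), e, d8 j hj, d9 j hj, Weight.val]
    rw [e, d9 j hj]
    exact Weight.den_ne_zero _
  have nonneg : ∀ (w : Weight) {z : ℤ}, (z : ℚ) = w.val * scale (σ 0) N → 0 ≤ z := by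
    intro w z hz
    have : (0 : ℚ) ≤ z := hz ▸ mul_nonneg w.nonneg hS.le
    exact_mod_cast this
  have hlen : σ 0 0 = (4 * N + 5 : ℕ) := by
    rw [← hσ, hN, ← I.length_encode]
    rfl
  obtain ⟨X, hX, hout, hopt⟩ := run_repair (σ := σ) (M := 4 * N + 5) (N := N)
    (A := fun j => I.fact j 0) (B := fun j => I.fact j 1) hlen (by rw [← hσ]; rfl) (by omega)
    (fun a ha i => by rw [← hσ, init, if_neg fun h => ha h.1]) dA dB (nonneg _ s₁) (nonneg _ s₂)
  refine ⟨X, hX, by rw [hσ]; exact hout, ?_, ?_⟩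
  · rw [← I.image_fact]
    exact Finset.image_subset_image hX
  · intro E hE
    rw [← I.image_fact, Finset.subset_image_iff] at hE
    obtain ⟨X', hX', rfl⟩ := hE
    -- Multiplication by the positive scale turns rational costs into the integral costs that the
    -- program compares.
    rw [← mul_le_mul_iff_left₀ hS, I.cost_image hX _ _ s₃ s₁ s₂, I.cost_image hX' _ _ s₃ s₁ s₂]
    exact_mod_cast hopt X' hX'

end SoftRepair

theorem mainTheorem2 :
    SoftRepair.SolvableInPolyTime 2
      [⟨{SoftRepair.attrA}, {SoftRepair.attrB}⟩, ⟨{SoftRepair.attrB}, {SoftRepair.attrA}⟩] := by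
  refine RAM.polyTimeSolvable_of_loopProg SoftRepair.repair SoftRepair.repair_tame
    (2 * Polynomial.X) (fun I => ?_) fun I => ?_
  · obtain ⟨X, hX, hout, hopt⟩ := SoftRepair.repair_correct I
    refine ⟨_, ⟨hopt.1, ?_⟩, hopt⟩
    rw [hout]
    refine List.ext_getElem (by simp) fun j h₁ h₂ => ?_
    have hj : j < I.facts.length := by simpa using h₁
    rw [List.getElem_ofFn, List.getElem_map, ← I.fact_eq hj]
    have : j ∈ X ↔ I.fact j ∈ X.image I.fact := by
      refine ⟨Finset.mem_image_of_mem _, fun h => ?_⟩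
      obtain ⟨i, hi, e⟩ := Finset.mem_image.1 h
      exact I.fact_injOn (hX hi) (by simpa using hj) e ▸ hi
    simp only [this]
  · obtain ⟨X, -, hout, -⟩ := SoftRepair.repair_correct I
    have h₁ := RAM.length_le_size (I.encode SoftRepair.bothFDs)
    rw [I.length_encode] at h₁
    have h₂ : RAM.size (RAM.output (SoftRepair.repair.run (RAM.init
        (I.encode SoftRepair.bothFDs)))) ≤ I.facts.length * 2 := by
      rw [hout, RAM.size]
      -- The entries `0` and `1` have length at most `2`, including the sign bit.
      refine (List.sum_le_card_nsmul _ 2 fun l hl => ?_).trans_eq (by simp)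
      obtain ⟨z, hz, rfl⟩ := List.mem_map.1 hl
      obtain ⟨j, rfl⟩ := (List.mem_ofFn' _ _).1 hz
      dsimp only
      split_ifs <;> decide
    simp only [Polynomial.eval_mul, Polynomial.eval_X, Polynomial.eval_ofNat]
    change _ ≤ 2 * RAM.size (I.encode SoftRepair.bothFDs)
    exact h₂.trans (by omega)
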